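/- Let $X=\{X_s\}_{s\ge 0}$ be a one-dimensional symmetric Lévy process started at $0$, with characteristic exponent $\Psi:\mathbb R\to[0,\infty)$, i.e. $\mathbb E[e^{-ixX_s}]=e^{-s\Psi(x)}$ for all $s\ge 0$, $x\in\mathbb R$. Assume that $\Psi(x)=\Psi(|x|)$, that $\Psi$ is non-decreasing on $[0,\infty)$, and that $$\lim_{x\to0^+}\frac{\Psi(x)}{x^2}=\ell\in(0,\infty),\qquad \lim_{x\to\infty}\frac{\Psi(x)}{\ln(|x|+1)}=\infty,\qquad \int_{\mathbb R}\frac{dx}{1+\Psi(x)}<\infty .$$ For $\delta>0$ put $\underline{\ell}(\delta)=\inf_{0<|x|\le\delta}\Psi(x)/x^2$. Let $\{a(n)\}_{n\in\mathbb N}$ be a non-decreasing sequence of positive numbers with $a(n)\to\infty$. Let $f:\mathbb R\to\mathbb C$ satisfy $f\in L^1(\mathbb R)\cap L^\infty(\mathbb R)$, $\widehat f\in L^1(\mathbb R)$ and $\int_{\mathbb R}|\widehat f(x)-\widehat f(0)|\,x^{-2}\,dx<\infty$, where $\widehat f(x)=\int_{\mathbb R}e^{-ixy}f(y)\,dy$.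 Fix $t>0$ and set $$I_n(t)=\frac1{a(n)}\int_0^{t^2a(n)^2}f(X_s)\,ds .$$ Then there are random variables $I^{(1)}_{n,\delta}(t)$ (complex-valued) and $I^{(2)}_{n,\delta}(t)$ (real-valued), $n\in\mathbb N$, $\delta>0$, such that $I_n(t)=I^{(1)}_{n,\delta}(t)+\widehat f(0)\,I^{(2)}_{n,\delta}(t)$ for all $n$ and $\delta$, and: (i) for every $\delta>0$, $I^{(1)}_{n,\delta}(t)\to0$ in $L^2$ as $n\to\infty$; (ii) for every $\delta>0$ and every integer $k\ge1$, $$\sup_{n\in\mathbb N}\mathbb E\Big[\big|I^{(2)}_{n,\delta}(t)\big|^{2k}\Big]\le\Big(\frac{t^2}{4\,\underline{\ell}(2k\delta)}\Big)^k\frac{(2k)!}{k!},$$ and the sequence $\{(I^{(2)}_{n,\delta}(t))^k:n\in\mathbb N\}$ is uniformly integrable. Furthermore, for every integer $k\ge1$, $$\lim_{\delta\to0^+}\liminf_{n\to\infty}\mathbb E\Big[\big(I^{(2)}_{n,\delta}(t)\big)^k\Big]=\lim_{\delta\to0^+}\limsup_{n\to\infty}\mathbb E\Big[\big(I^{(2)}_{n,\delta}(t)\big)^k\Big]=\Big(\frac{t}{2\sqrt{\ell}}\Big)^k\frac{k!}{\Gamma(1+k/2)}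 .$$ -/

import Mathlib

open MeasureTheory ProbabilityTheory Filter Topology
open scoped NNReal ENNReal

/-- A one-dimensional Lévy process on `(Ω, P)`: it starts at zero, has independent and stationary
increments, and almost surely its paths are right continuous with left limits. -/
structure IsLevyProcess {Ω : Type*} [MeasurableSpace Ω] (X : ℝ≥0 → Ω → ℝ) (P : Measure Ω) :
    Prop where
  measurable : ∀ t, Measurable (X t)
  start_zero : ∀ᵐ ω ∂P, X 0 ω = 0
  indep_increments : HasIndepIncrements X P
  stationary_increments : ∀ s t : ℝ≥0,
    IdentDistrib (fun ω => X (s + t) ω - X s ω) (X t) P P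
  cadlag : ∀ᵐ ω ∂P, ∀ t : ℝ≥0,
    ContinuousWithinAt (fun s => X s ω) (Set.Ici t) t ∧
      ∃ l : ℝ, Tendsto (fun s => X s ω) (𝓝[<] t) (𝓝 l)

/-- The process is symmetric: `X t` and `-X t` have the same law. -/
def IsSymmetricProcess {Ω : Type*} [MeasurableSpace Ω] (X : ℝ≥0 → Ω → ℝ) (P : Measure Ω) :
    Prop :=
  ∀ t, IdentDistrib (X t) (fun ω => -X t ω) P P

/-- The real function `Ψ` is the characteristic exponent of `X`:
`E [exp (-i x X_s)] = exp (-s Ψ(x))`. -/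
def HasCharExponent {Ω : Type*} [MeasurableSpace Ω] (X : ℝ≥0 → Ω → ℝ) (P : Measure Ω)
    (Ψ : ℝ → ℝ) : Prop :=
  ∀ (s : ℝ≥0) (x : ℝ),
    ∫ ω, Complex.exp (-(Complex.I * (x : ℂ) * (X s ω : ℂ))) ∂P =
      Complex.exp (-(((s : ℝ) : ℂ) * (Ψ x : ℂ)))

/-- The infimum of `Ψ(x) / x²` over `0 < |x| ≤ δ`. -/
noncomputable def ellLower (Ψ : ℝ → ℝ) (δ : ℝ) : ℝ :=
  sInf ((fun x : ℝ => Ψ x / x ^ 2) '' {x : ℝ | x ≠ 0 ∧ |x| ≤ δ})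

/-- The Fourier transform `x ↦ ∫ exp (-i x y) f(y) dy`, in the angular normalization. -/
noncomputable def angularFourier (f : ℝ → ℂ) (x : ℝ) : ℂ :=
  ∫ y : ℝ, Complex.exp (-(Complex.I * (x : ℂ) * (y : ℂ))) * f y

/-- The class of admissible functions: `f ∈ L¹ ∩ L^∞`, its Fourier transform is in `L¹`, and
`|f̂(x) - f̂(0)| / x²` is integrable. -/
structure IsAdmissible (f : ℝ → ℂ) : Prop where
  memLp_one : MemLp f 1 volume
  memLp_top : MemLp f ∞ volume
  fourier_integrable : Integrable (angularFourier f) volume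
  fourier_sub_integrable :
    Integrable (fun x : ℝ => ‖angularFourier f x - angularFourier f 0‖ / x ^ 2) volume

/-- The normalized additive functional `b⁻¹ ∫₀^{t² b²} f(X_s) ds`. -/
noncomputable def additiveFunctional {Ω : Type*} (X : ℝ≥0 → Ω → ℝ) (f : ℝ → ℂ) (b t : ℝ)
    (ω : Ω) : ℂ :=
  (b : ℂ)⁻¹ * ∫ s in (0 : ℝ)..(t ^ 2 * b ^ 2), f (X s.toNNReal ω)

/-
Fourier inversion writes `f(X_s)` as a superposition of phases `exp (i x X_s)` weighted by
`f̂(x) / 2π`. The frequencies `|x| ≤ δ`, with `f̂(x)` replaced by `f̂(0)`, give `f̂(0) I⁽²⁾`, the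
occupation functional of a sinc kernel. The remaining spectrum vanishes at `x = 0` fast enough
that, by the explicit two-time characteristic function, its time integral over `[0, T]` is
`o(√T)` in `L²`. The `k`-th moment of `I⁽²⁾` is `k!` times an iterated integral of exponentials of
`-s Ψ` over simplices in time and windows in frequency. Diffusive scaling replaces `Ψ(v)` by
`a² Ψ(v / a) → ℓ v²` and lets the window fill `ℝ`, where the iterated integral is Gaussian and
reduces to Beta integrals. Along a chain of `k` windows the frequencies never exceed `kδ`, where
`Ψ(v) ≥ ellLower Ψ (kδ) v²`: this bounds the moments and supplies the dominating function.
-/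

section ChainKernel

/-- The iterated kernel through which the moments of an additive functional of a process with
characteristic exponent `Φ` are expressed; `S` is the set of frequencies that the functional
charges. The first argument counts the factors, `τ` is the remaining time and `v` the current
frequency. -/
noncomputable def chainKernel (Φ : ℝ → ℝ) (S : Set ℝ) : ℕ → ℝ → ℝ → ℝ≥0∞
  | 0, τ, v => ENNReal.ofReal (Real.exp (-(τ * Φ v)))
  | k + 1, τ, v => ∫⁻ σ in Set.Ioc 0 τ, ENNReal.ofReal (Real.exp (-((τ - σ) * Φ v))) *
      (ENNReal.ofReal (2 * Real.pi)⁻¹ * ∫⁻ x in S, chainKernel Φ S k σ (v + x))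

/-- The average of `chainKernel` over the next frequency, with the factor `(2π)⁻¹` of Fourier
inversion. -/
noncomputable def chainMass (Φ : ℝ → ℝ) (S : Set ℝ) (k : ℕ) (τ v : ℝ) : ℝ≥0∞ :=
  ENNReal.ofReal (2 * Real.pi)⁻¹ * ∫⁻ x in S, chainKernel Φ S k τ (v + x)

variable {Φ Φ' : ℝ → ℝ} {S : Set ℝ} {k : ℕ} {τ σ d v b c : ℝ}

theorem chainKernel_succ : chainKernel Φ S (k + 1) τ v =
    ∫⁻ σ in Set.Ioc 0 τ, ENNReal.ofReal (Real.exp (-((τ - σ) * Φ v))) * chainMass Φ S k σ v :=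
  rfl

theorem chainMass_univ :
    chainMass Φ Set.univ k τ v =
      ENNReal.ofReal (2 * Real.pi)⁻¹ * ∫⁻ x, chainKernel Φ Set.univ k τ x := by
  rw [chainMass, Measure.restrict_univ, lintegral_add_left_eq_self (chainKernel Φ Set.univ k τ)]

theorem measurable_chainMass_of_chainKernel
    (h : Measurable fun p : ℝ × ℝ => chainKernel Φ S k p.1 p.2) :
    Measurable fun p : ℝ × ℝ => chainMass Φ S k p.1 p.2 := by
  have hshift : Measurable fun q : (ℝ × ℝ) × ℝ => chainKernel Φ S k q.1.1 (q.1.2 + q.2) :=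
    h.comp (f := fun q : (ℝ × ℝ) × ℝ => (q.1.1, q.1.2 + q.2)) (by fun_prop)
  exact hshift.lintegral_prod_right'.const_mul _

theorem measurable_chainKernel (hΦ : Measurable Φ) (S : Set ℝ) (k : ℕ) :
    Measurable fun p : ℝ × ℝ => chainKernel Φ S k p.1 p.2 := by
  induction k with
  | zero => simp only [chainKernel]; fun_prop
  | succ k ih =>
    have hmass : Measurable fun q : (ℝ × ℝ) × ℝ => chainMass Φ S k q.2 q.1.2 :=
      (measurable_chainMass_of_chainKernel ih).comp
        (f := fun q : (ℝ × ℝ) × ℝ => (q.2, q.1.2)) (by fun_prop)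
    have hset : MeasurableSet {q : (ℝ × ℝ) × ℝ | 0 < q.2 ∧ q.2 ≤ q.1.1} :=
      (measurableSet_lt measurable_const measurable_snd).inter
        (measurableSet_le measurable_snd (by fun_prop))
    have hind : Measurable ({q : (ℝ × ℝ) × ℝ | 0 < q.2 ∧ q.2 ≤ q.1.1}.indicator
        fun q => ENNReal.ofReal (Real.exp (-((q.1.1 - q.2) * Φ q.1.2))) *
          chainMass Φ S k q.2 q.1.2) :=
      Measurable.indicator (by fun_prop) hset
    convert hind.lintegral_prod_right' (ν := volume) using 2 with p
    rw [chainKernel_succ, ← lintegral_indicator measurableSet_Ioc]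
    rfl

theorem measurable_chainMass (hΦ : Measurable Φ) (S : Set ℝ) (k : ℕ) :
    Measurable fun p : ℝ × ℝ => chainMass Φ S k p.1 p.2 :=
  measurable_chainMass_of_chainKernel (measurable_chainKernel hΦ S k)

theorem measurable_chainKernel_right (hΦ : Measurable Φ) (S : Set ℝ) (k : ℕ) (τ : ℝ) :
    Measurable (chainKernel Φ S k τ) :=
  (measurable_chainKernel hΦ S k).comp measurable_prodMk_left

theorem measurable_chainMass_left (hΦ : Measurable Φ) (S : Set ℝ) (k : ℕ) (v : ℝ) :
    Measurable fun τ => chainMass Φ S k τ v :=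
  (measurable_chainMass hΦ S k).comp measurable_prodMk_right

theorem ofReal_exp_neg_mul_le_one {s q : ℝ} (hs : 0 ≤ s) (hq : 0 ≤ q) :
    ENNReal.ofReal (Real.exp (-(s * q))) ≤ 1 := by
  rw [ENNReal.ofReal_le_one, Real.exp_le_one_iff, neg_nonpos]
  exact mul_nonneg hs hq

theorem exists_chainKernel_le (hΦ : ∀ x, 0 ≤ Φ x) (hS : volume S ≠ ∞) (T : ℝ) (k : ℕ) :
    ∃ C : ℝ≥0∞, C ≠ ∞ ∧ ∀ τ, 0 ≤ τ → τ ≤ T → ∀ v, chainKernel Φ S k τ v ≤ C := by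
  induction k with
  | zero => exact ⟨1, by simp, fun τ h0 _ v => ofReal_exp_neg_mul_le_one h0 (hΦ v)⟩
  | succ k ih =>
    obtain ⟨C, hC, h⟩ := ih
    have hmass : ∀ τ, 0 ≤ τ → τ ≤ T → ∀ v,
        chainMass Φ S k τ v ≤ ENNReal.ofReal (2 * Real.pi)⁻¹ * (C * volume S) := by
      intro τ h0 hT v
      rw [chainMass, ← setLIntegral_const]
      gcongr
      exact h τ h0 hT _
    refine ⟨ENNReal.ofReal T * (ENNReal.ofReal (2 * Real.pi)⁻¹ * (C * volume S)),
      by finiteness, fun τ _ hT v => ?_⟩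
    calc chainKernel Φ S (k + 1) τ v
        ≤ ∫⁻ _ in Set.Ioc 0 τ, 1 * (ENNReal.ofReal (2 * Real.pi)⁻¹ * (C * volume S)) :=
          setLIntegral_mono measurable_const fun σ hσ =>
            mul_le_mul' (ofReal_exp_neg_mul_le_one (sub_nonneg.2 hσ.2) (hΦ v))
              (hmass σ hσ.1.le (hσ.2.trans hT) v)
      _ ≤ ENNReal.ofReal T * (ENNReal.ofReal (2 * Real.pi)⁻¹ * (C * volume S)) := by
          rw [setLIntegral_const, one_mul, mul_comm]
          gcongr
          simpa using ENNReal.ofReal_le_ofReal hT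

theorem chainKernel_lt_top (hΦ : ∀ x, 0 ≤ Φ x) (hS : volume S ≠ ∞) (k : ℕ) (hτ : 0 ≤ τ) (v : ℝ) :
    chainKernel Φ S k τ v < ∞ := by
  obtain ⟨C, hC, h⟩ := exists_chainKernel_le hΦ hS τ k
  exact (h τ hτ le_rfl v).trans_lt hC.lt_top

theorem chainMass_lt_top (hΦ : ∀ x, 0 ≤ Φ x) (hS : volume S ≠ ∞) (k : ℕ) (hτ : 0 ≤ τ) (v : ℝ) :
    chainMass Φ S k τ v < ∞ := by
  obtain ⟨C, hC, h⟩ := exists_chainKernel_le hΦ hS τ k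
  refine ENNReal.mul_lt_top ENNReal.ofReal_lt_top
    ((setLIntegral_mono measurable_const fun x _ => h τ hτ le_rfl _).trans_lt ?_)
  rw [setLIntegral_const]
  exact ENNReal.mul_lt_top hC.lt_top hS.lt_top

theorem chainKernel_le_chainKernel (hd : 0 ≤ d) (hS : MeasurableSet S) (hSd : ∀ x ∈ S, |x| ≤ d)
    {R : ℝ} (hle : ∀ v, |v| ≤ R → Φ' v ≤ Φ v) (hτ : 0 ≤ τ) (hv : |v| + k * d ≤ R) :
    chainKernel Φ S k τ v ≤ chainKernel Φ' Set.univ k τ v := by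
  have hexp : ∀ s v, 0 ≤ s → |v| ≤ R → ENNReal.ofReal (Real.exp (-(s * Φ v))) ≤
      ENNReal.ofReal (Real.exp (-(s * Φ' v))) := by
    intro s v hs hv
    gcongr
    exact hle v hv
  induction k generalizing τ v with
  | zero => exact hexp _ _ hτ (by simpa using hv)
  | succ k ih =>
    push_cast at hv
    have hkd : 0 ≤ k * d := by positivity
    refine setLIntegral_mono' measurableSet_Ioc fun σ hσ => ?_
    gcongr ?_ * (_ * ?_)
    · exact hexp _ _ (sub_nonneg.2 hσ.2) (by linarith)
    · refine (setLIntegral_mono' hS fun x hx => ih hσ.1.le ?_).trans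
        (lintegral_mono_set (Set.subset_univ S))
      linarith [abs_add_le v x, hSd x hx]

theorem lintegral_rpow_mul_sub_rpow {α β τ : ℝ} (hα : 0 < α) (hβ : 0 < β) (hτ : 0 < τ) :
    ∫⁻ σ in Set.Ioc 0 τ, ENNReal.ofReal (σ ^ (α - 1) * (τ - σ) ^ (β - 1)) =
      ENNReal.ofReal (τ ^ (α + β - 1) *
        (Real.Gamma α * Real.Gamma β / Real.Gamma (α + β))) := by
  have hintegrand : ∀ x ∈ Set.Ioc 0 τ, (x : ℂ) ^ ((α : ℂ) - 1) * ((τ : ℂ) - x) ^ ((β : ℂ) - 1) =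
      ((x ^ (α - 1) * (τ - x) ^ (β - 1) : ℝ) : ℂ) := by
    intro x hx
    push_cast [Complex.ofReal_cpow hx.1.le, Complex.ofReal_cpow (sub_nonneg.2 hx.2)]
    rfl
  have hpow : (τ : ℂ) ^ ((α : ℂ) + β - 1) = ((τ ^ (α + β - 1) : ℝ) : ℂ) := by
    push_cast [Complex.ofReal_cpow hτ.le]; rfl
  have hvalue : ∫ x in Set.Ioc 0 τ, x ^ (α - 1) * (τ - x) ^ (β - 1) =
      τ ^ (α + β - 1) * (Real.Gamma α * Real.Gamma β / Real.Gamma (α + β)) := by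
    have hbeta := Complex.betaIntegral_scaled α β hτ
    rw [Complex.betaIntegral_eq_Gamma_mul_div _ _ (by simpa) (by simpa), hpow,
      intervalIntegral.integral_of_le hτ.le, setIntegral_congr_fun measurableSet_Ioc hintegrand,
      integral_complex_ofReal, ← Complex.ofReal_add, Complex.Gamma_ofReal, Complex.Gamma_ofReal,
      Complex.Gamma_ofReal] at hbeta
    exact_mod_cast hbeta
  have hne : ∫ x in Set.Ioc 0 τ, x ^ (α - 1) * (τ - x) ^ (β - 1) ≠ 0 := by
    rw [hvalue]
    have := Real.Gamma_pos_of_pos hα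
    have := Real.Gamma_pos_of_pos hβ
    have := Real.Gamma_pos_of_pos (add_pos hα hβ)
    positivity
  rw [← ofReal_integral_eq_lintegral_ofReal (not_imp_comm.1 integral_undef hne), hvalue]
  filter_upwards [ae_restrict_mem measurableSet_Ioc] with x hx
  have := hx.1
  have := sub_nonneg.2 hx.2
  positivity

theorem inv_two_pi_mul_lintegral_exp_neg_mul_sq (hb : 0 < b) {s : ℝ} (hs : 0 < s) :
    ENNReal.ofReal (2 * Real.pi)⁻¹ * ∫⁻ x : ℝ, ENNReal.ofReal (Real.exp (-(s * (b * x ^ 2)))) =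
      ENNReal.ofReal (1 / (2 * √b) / Real.Gamma (1 / 2) * s ^ ((1 : ℝ) / 2 - 1)) := by
  have hgauss : ∫⁻ x : ℝ, ENNReal.ofReal (Real.exp (-(s * (b * x ^ 2)))) =
      ENNReal.ofReal √(Real.pi / (s * b)) := by
    simp_rw [← mul_assoc s b, ← neg_mul (s * b)]
    rw [← integral_gaussian, ofReal_integral_eq_lintegral_ofReal
      (integrable_exp_neg_mul_sq (mul_pos hs hb)) (ae_of_all _ fun x => (Real.exp_pos _).le)]
  have hpow : s ^ ((1 : ℝ) / 2 - 1) = 1 / √s := by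
    rw [show (1 : ℝ) / 2 - 1 = -(1 / 2) by norm_num, Real.rpow_neg hs.le, ← Real.sqrt_eq_rpow,
      one_div]
  rw [hgauss, ← ENNReal.ofReal_mul (by positivity), hpow, Real.Gamma_one_half_eq,
    Real.sqrt_div Real.pi_pos.le, Real.sqrt_mul hs.le]
  congr 1
  field_simp
  rw [Real.sq_sqrt Real.pi_pos.le]

theorem inv_two_pi_mul_lintegral_chainKernel_succ (hΦ : Measurable Φ) :
    ENNReal.ofReal (2 * Real.pi)⁻¹ * ∫⁻ x, chainKernel Φ Set.univ (k + 1) τ x =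
      ∫⁻ σ in Set.Ioc 0 τ, (ENNReal.ofReal (2 * Real.pi)⁻¹ *
        ∫⁻ x, ENNReal.ofReal (Real.exp (-((τ - σ) * Φ x)))) * chainMass Φ Set.univ k σ 0 := by
  have hmass := measurable_chainMass_left hΦ Set.univ k 0
  have hjoint : Measurable fun p : ℝ × ℝ =>
      ENNReal.ofReal (Real.exp (-((τ - p.2) * Φ p.1))) * chainMass Φ Set.univ k p.2 0 := by
    fun_prop
  have hshift : ∀ σ x, chainMass Φ Set.univ k σ x = chainMass Φ Set.univ k σ 0 := fun σ x => by
    rw [chainMass_univ, chainMass_univ]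
  simp only [chainKernel_succ, hshift]
  rw [lintegral_lintegral_swap hjoint.aemeasurable,
    ← lintegral_const_mul _ (by exact (hjoint.comp measurable_swap).lintegral_prod_right')]
  refine lintegral_congr fun σ => ?_
  rw [lintegral_mul_const _ (by fun_prop), mul_assoc]

theorem chainMass_gaussian (hb : 0 < b) (k : ℕ) {τ : ℝ} (hτ : 0 < τ) (v : ℝ) :
    chainMass (fun v => b * v ^ 2) Set.univ k τ v =
      ENNReal.ofReal ((1 / (2 * √b)) ^ (k + 1) / Real.Gamma ((k + 1) / 2) *
        τ ^ (((k : ℝ) + 1) / 2 - 1)) := by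
  rw [chainMass_univ]
  induction k generalizing τ v with
  | zero => simpa [chainKernel] using inv_two_pi_mul_lintegral_exp_neg_mul_sq hb hτ
  | succ k ih =>
    have : 0 < Real.Gamma (((k : ℝ) + 1) / 2) := Real.Gamma_pos_of_pos (by positivity)
    have : 0 < Real.Gamma (1 / 2) := Real.Gamma_pos_of_pos (by positivity)
    obtain ⟨D, hD⟩ : ∃ D : ℝ, D = 1 / (2 * √b) / Real.Gamma (1 / 2) *
      ((1 / (2 * √b)) ^ (k + 1) / Real.Gamma ((k + 1) / 2)) := ⟨_, rfl⟩
    have hD0 : 0 ≤ D := by rw [hD]; positivity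
    rw [inv_two_pi_mul_lintegral_chainKernel_succ (by fun_prop)]
    calc _ = ∫⁻ σ in Set.Ioo 0 τ, ENNReal.ofReal D *
          ENNReal.ofReal (σ ^ (((k : ℝ) + 1) / 2 - 1) * (τ - σ) ^ ((1 : ℝ) / 2 - 1)) := by
          rw [setLIntegral_congr Ioo_ae_eq_Ioc.symm]
          refine setLIntegral_congr_fun measurableSet_Ioo fun σ hσ => ?_
          have hσ0 := hσ.1
          have hστ := sub_pos.2 hσ.2
          rw [inv_two_pi_mul_lintegral_exp_neg_mul_sq hb hστ, chainMass_univ, ih hσ0 0,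
            ← ENNReal.ofReal_mul (by positivity), ← ENNReal.ofReal_mul hD0, hD]
          congr 1
          ring
      _ = _ := by
          rw [setLIntegral_congr Ioo_ae_eq_Ioc, lintegral_const_mul _ (by fun_prop),
            lintegral_rpow_mul_sub_rpow (by positivity) (by norm_num) hτ,
            ← ENNReal.ofReal_mul hD0, hD,
            show ((k : ℝ) + 1) / 2 + 1 / 2 = (((k + 1 : ℕ) : ℝ) + 1) / 2 by push_cast; ring,
            pow_succ (1 / (2 * √b)) (k + 1)]
          congr 1
          field_simp

theorem chainKernel_gaussian_zero (hb : 0 < b) (k : ℕ) {τ : ℝ} (hτ : 0 < τ) :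
    chainKernel (fun v => b * v ^ 2) Set.univ k τ 0 =
      ENNReal.ofReal ((1 / (2 * √b)) ^ k * τ ^ ((k : ℝ) / 2) / Real.Gamma (1 + (k : ℝ) / 2)) := by
  cases k with
  | zero => simp [chainKernel]
  | succ k =>
    have : 0 < Real.Gamma (((k : ℝ) + 1) / 2) := Real.Gamma_pos_of_pos (by positivity)
    obtain ⟨D, hD⟩ : ∃ D : ℝ, D = (1 / (2 * √b)) ^ (k + 1) / Real.Gamma ((k + 1) / 2) := ⟨_, rfl⟩
    have hD0 : 0 ≤ D := by rw [hD]; positivity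
    rw [chainKernel_succ]
    calc _ = ∫⁻ σ in Set.Ioc 0 τ, ENNReal.ofReal D *
            ENNReal.ofReal (σ ^ (((k : ℝ) + 1) / 2 - 1) * (τ - σ) ^ ((1 : ℝ) - 1)) := by
          refine setLIntegral_congr_fun measurableSet_Ioc fun σ hσ => ?_
          rw [chainMass_gaussian hb k hσ.1, ← hD, ENNReal.ofReal_mul hD0]
          simp
      _ = _ := by
          rw [lintegral_const_mul _ (by fun_prop),
            lintegral_rpow_mul_sub_rpow (by positivity) (by norm_num) hτ,
            ← ENNReal.ofReal_mul hD0, hD, Real.Gamma_one,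
            show ((k : ℝ) + 1) / 2 + 1 = 1 + ((k + 1 : ℕ) : ℝ) / 2 by push_cast; ring,
            add_sub_cancel_left]
          congr 1
          field_simp

theorem lintegral_chainKernel_gaussian_ne_top (hb : 0 < b) (k : ℕ) (hτ : 0 < τ) :
    ∫⁻ x, chainKernel (fun v => b * v ^ 2) Set.univ k τ x ≠ ∞ := by
  intro h
  have := chainMass_gaussian hb k hτ 0
  rw [chainMass_univ, h, ENNReal.mul_top (by simp [Real.pi_pos])] at this
  exact ENNReal.ofReal_ne_top this.symm

theorem lintegral_chainMass_gaussian_ne_top (hb : 0 < b) (k : ℕ) (hτ : 0 ≤ τ) (v : ℝ) :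
    ∫⁻ σ in Set.Ioc 0 τ, chainMass (fun v => b * v ^ 2) Set.univ k σ v ≠ ∞ := by
  rcases hτ.eq_or_lt with rfl | hτ
  · simp
  · have hzero := chainKernel_gaussian_zero hb (k + 1) hτ
    have hmass : ∀ σ, chainMass (fun v => b * v ^ 2) Set.univ k σ 0 =
        chainMass (fun v => b * v ^ 2) Set.univ k σ v := fun σ => by simp only [chainMass_univ]
    simp only [chainKernel_succ, ne_eq, OfNat.ofNat_ne_zero, not_false_eq_true, zero_pow,
      mul_zero, neg_zero, Real.exp_zero, ENNReal.ofReal_one, one_mul, hmass] at hzero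
    exact hzero ▸ ENNReal.ofReal_ne_top

theorem chainKernel_add_le_gaussian (hv : |v| ≤ d)
    (hlow : ∀ u, |u| ≤ (k + 2) * d → c * u ^ 2 ≤ Φ u) (hτ : 0 ≤ τ) {x : ℝ}
    (hx : x ∈ Set.Ioc (-d) d) :
    chainKernel Φ (Set.Ioc (-d) d) k τ (v + x) ≤
      chainKernel (fun u => c * u ^ 2) Set.univ k τ (v + x) := by
  have hd : 0 ≤ d := (abs_nonneg v).trans hv
  have hxd : ∀ y ∈ Set.Ioc (-d) d, |y| ≤ d := fun y hy => abs_le.2 ⟨hy.1.le, hy.2⟩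
  refine chainKernel_le_chainKernel hd measurableSet_Ioc hxd hlow hτ ?_
  linarith [abs_add_le v x, hxd x hx]

section Limit

variable {ι : Type*} {l : Filter ι} [l.IsCountablyGenerated] {F : ι → ℝ → ℝ} {d : ι → ℝ}

theorem tendsto_chainMass (hF : ∀ i, Measurable (F i)) (hd : Tendsto d l atTop) (hc : 0 < c)
    (hlow : ∀ i u, |u| ≤ (k + 2) * d i → c * u ^ 2 ≤ F i u) (hτ : 0 < τ)
    (hlim : ∀ x, Tendsto (fun i => chainKernel (F i) (Set.Ioc (-d i) (d i)) k τ x) l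
      (𝓝 (chainKernel Φ Set.univ k τ x))) (v : ℝ) :
    Tendsto (fun i => chainMass (F i) (Set.Ioc (-d i) (d i)) k τ v) l
      (𝓝 (chainMass Φ Set.univ k τ v)) := by
  refine ENNReal.Tendsto.const_mul ?_ (Or.inr ENNReal.ofReal_ne_top)
  simp_rw [← lintegral_indicator measurableSet_Ioc, Measure.restrict_univ]
  refine tendsto_lintegral_filter_of_dominated_convergence
    (fun x => chainKernel (fun u => c * u ^ 2) Set.univ k τ (v + x)) ?_ ?_ ?_ ?_
  · exact Eventually.of_forall fun i => ((measurable_chainKernel_right (hF i) _ k τ).comp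
      (measurable_const_add v)).indicator measurableSet_Ioc
  · filter_upwards [hd.eventually_ge_atTop |v|] with i hi
    exact ae_of_all _ fun x => Set.indicator_apply_le'
      (chainKernel_add_le_gaussian hi (hlow i) hτ.le) fun _ => zero_le
  · rw [lintegral_add_left_eq_self (chainKernel (fun u => c * u ^ 2) Set.univ k τ)]
    exact lintegral_chainKernel_gaussian_ne_top hc k hτ
  · refine ae_of_all _ fun x => (hlim (v + x)).congr' ?_
    filter_upwards [hd.eventually_gt_atTop |x|] with i hi
    rw [Set.indicator_of_mem]
    exact ⟨(abs_lt.1 hi).1, (abs_lt.1 hi).2.le⟩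

theorem tendsto_chainKernel (hF : ∀ i, Measurable (F i)) (hd : Tendsto d l atTop) (hb : 0 < b)
    (hlim : ∀ v, Tendsto (fun i => F i v) l (𝓝 (b * v ^ 2)))
    (hlow : ∀ R : ℝ, 0 < R → ∃ c, 0 < c ∧ ∀ i v, |v| ≤ R * d i → c * v ^ 2 ≤ F i v)
    (k : ℕ) (hτ : 0 ≤ τ) (v : ℝ) :
    Tendsto (fun i => chainKernel (F i) (Set.Ioc (-d i) (d i)) k τ v) l
      (𝓝 (chainKernel (fun v => b * v ^ 2) Set.univ k τ v)) := by
  have hexp : ∀ s v, Tendsto (fun i => ENNReal.ofReal (Real.exp (-(s * F i v)))) l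
      (𝓝 (ENNReal.ofReal (Real.exp (-(s * (b * v ^ 2)))))) := fun s v =>
    ENNReal.tendsto_ofReal ((Real.continuous_exp.tendsto _).comp ((hlim v).const_mul s).neg)
  induction k generalizing τ v with
  | zero => exact hexp τ v
  | succ k ih =>
    obtain ⟨c, hc, hcF⟩ := hlow (k + 2) (by positivity)
    simp only [chainKernel_succ]
    refine tendsto_lintegral_filter_of_dominated_convergence
      (fun σ => chainMass (fun u => c * u ^ 2) Set.univ k σ v) ?_ ?_
      (lintegral_chainMass_gaussian_ne_top hc k hτ v) ?_
    · refine Eventually.of_forall fun i => ?_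
      have := measurable_chainMass_left (hF i) (Set.Ioc (-d i) (d i)) k v
      fun_prop
    · filter_upwards [hd.eventually_ge_atTop |v|] with i hi
      have hd0 : 0 ≤ d i := (abs_nonneg v).trans hi
      have hFv : 0 ≤ F i v :=
        (by positivity : 0 ≤ c * v ^ 2).trans (hcF i v (hi.trans (by nlinarith)))
      filter_upwards [ae_restrict_mem measurableSet_Ioc] with σ hσ
      refine (mul_le_of_le_one_left' (ofReal_exp_neg_mul_le_one (sub_nonneg.2 hσ.2) hFv)).trans ?_
      exact mul_right_mono ((setLIntegral_mono' measurableSet_Ioc fun x =>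
        chainKernel_add_le_gaussian hi (hcF i) hσ.1.le).trans
          (lintegral_mono_set (Set.subset_univ _)))
    · filter_upwards [ae_restrict_mem measurableSet_Ioc] with σ hσ
      refine ENNReal.Tendsto.mul (hexp _ v) (Or.inr ?_)
        (tendsto_chainMass hF hd hc hcF hσ.1 (ih hσ.1.le) v)
        (Or.inr ENNReal.ofReal_ne_top)
      rw [chainMass_gaussian hb k hσ.1]
      exact ENNReal.ofReal_ne_top

end Limit

end ChainKernel

section RegularLevy

variable {Ω : Type*}

theorem tendsto_floor_mul_add_one_div (s : ℝ) :
    Tendsto (fun n : ℕ => ((⌊((n : ℝ) + 1) * s⌋ : ℝ) + 1) / ((n : ℝ) + 1)) atTop (𝓝[>] s) := by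
  have hpos : ∀ n : ℕ, (0 : ℝ) < (n : ℝ) + 1 := fun n => by positivity
  have hlt : ∀ n : ℕ, s < ((⌊((n : ℝ) + 1) * s⌋ : ℝ) + 1) / ((n : ℝ) + 1) := fun n => by
    rw [lt_div_iff₀ (hpos n), mul_comm]
    exact Int.lt_floor_add_one _
  have hle : ∀ n : ℕ, ((⌊((n : ℝ) + 1) * s⌋ : ℝ) + 1) / ((n : ℝ) + 1) ≤ s + 1 / ((n : ℝ) + 1) :=
    fun n => by
      rw [div_le_iff₀ (hpos n), add_mul s, one_div_mul_cancel (hpos n).ne', mul_comm s]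
      gcongr
      exact Int.floor_le _
  have hlim : Tendsto (fun n : ℕ => s + 1 / ((n : ℝ) + 1)) atTop (𝓝 s) := by
    simpa using tendsto_one_div_add_atTop_nhds_zero_nat.const_add s
  exact tendsto_nhdsWithin_iff.2
    ⟨tendsto_of_tendsto_of_tendsto_of_le_of_le tendsto_const_nhds hlim (fun n => (hlt n).le) hle,
      Eventually.of_forall hlt⟩

theorem measurable_uncurry_of_rightContinuous {m : MeasurableSpace Ω} {W : ℝ → Ω → ℝ}
    (hm : ∀ r, Measurable (W r))
    (hr : ∀ ω s, ContinuousWithinAt (fun r => W r ω) (Set.Ioi s) s) :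
    Measurable fun p : ℝ × Ω => W p.1 p.2 := by
  refine measurable_of_tendsto_metrizable
    (f := fun (n : ℕ) (p : ℝ × Ω) =>
      W (((⌊((n : ℝ) + 1) * p.1⌋ : ℝ) + 1) / ((n : ℝ) + 1)) p.2)
    (fun n => ?_) (tendsto_pi_nhds.2 fun p =>
      (hr p.2 p.1).tendsto.comp (tendsto_floor_mul_add_one_div p.1))
  have hint : Measurable fun q : ℤ × Ω => W (((q.1 : ℝ) + 1) / ((n : ℝ) + 1)) q.2 :=
    measurable_from_prod_countable_right fun k => hm (((k : ℝ) + 1) / ((n : ℝ) + 1))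
  have hgrid : Measurable fun p : ℝ × Ω => (⌊((n : ℝ) + 1) * p.1⌋, p.2) := by fun_prop
  exact hint.comp hgrid

theorem measurable_integral_of_rightContinuous {m : MeasurableSpace Ω} {W : ℝ → Ω → ℝ}
    (hm : ∀ r, Measurable (W r))
    (hr : ∀ ω s, ContinuousWithinAt (fun r => W r ω) (Set.Ioi s) s) {g : ℝ → ℝ}
    (hg : Measurable g) (A : Set ℝ) :
    Measurable fun ω => ∫ r in A, g (W r ω) := by
  have h : StronglyMeasurable fun p : Ω × ℝ => g (W p.2 p.1) :=
    (hg.comp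
      ((measurable_uncurry_of_rightContinuous hm hr).comp measurable_swap)).stronglyMeasurable
  exact (h.integral_prod_right' (ν := volume.restrict A)).measurable

/-- The σ-algebra generated by the path of `Z` up to time `s`. -/
abbrev pathAlgebra (Z : ℝ → Ω → ℝ) (s : ℝ) : MeasurableSpace Ω :=
  MeasurableSpace.comap (fun ω (r : Set.Iic s) => Z r ω) inferInstance

theorem measurable_eval_pathAlgebra (Z : ℝ → Ω → ℝ) {r s : ℝ} (hrs : r ≤ s) :
    Measurable[pathAlgebra Z s] (Z r) :=
  (measurable_pi_apply (⟨r, hrs⟩ : Set.Iic s)).comp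
    (comap_measurable fun ω (r : Set.Iic s) => Z r ω)

/-- The additive functional `∫₀^τ g(Z_r) dr`. -/
noncomputable def occupation (Z : ℝ → Ω → ℝ) (g : ℝ → ℝ) (τ : ℝ) (ω : Ω) : ℝ :=
  ∫ r in (0 : ℝ)..τ, g (Z r ω)

theorem abs_occupation_le {Z : ℝ → Ω → ℝ} {g : ℝ → ℝ} {B : ℝ} (hB : ∀ y, |g y| ≤ B) {τ : ℝ}
    (hτ : 0 ≤ τ) (ω : Ω) : |occupation Z g τ ω| ≤ B * τ := by
  have := intervalIntegral.norm_integral_le_of_norm_le_const (a := 0) (b := τ) (C := B)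
    (f := fun r => g (Z r ω)) fun x _ => hB _
  rwa [sub_zero, abs_of_nonneg hτ] at this

variable [mΩ : MeasurableSpace Ω]

/-- A Lévy process with exponent `Ψ` in which every path, and not only almost every path, is right
continuous. Time is real-valued so that interval integrals apply; only nonnegative times matter. -/
structure IsRegularLevy (Z : ℝ → Ω → ℝ) (P : Measure Ω) (Ψ : ℝ → ℝ) : Prop where
  measurable : ∀ s, Measurable (Z s)
  rightContinuous : ∀ ω s, ContinuousWithinAt (fun r => Z r ω) (Set.Ioi s) s
  start_zero : ∀ᵐ ω ∂P, Z 0 ω = 0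
  indep : ∀ s τ, 0 ≤ s → s ≤ τ →
    IndepFun (fun ω (r : Set.Iic s) => Z r ω) (fun ω => Z τ ω - Z s ω) P
  integral_exp_sub : ∀ s τ u, 0 ≤ s → s ≤ τ →
    ∫ ω, Complex.exp (Complex.I * (u * (Z τ ω - Z s ω) : ℝ)) ∂P =
      (Real.exp (-((τ - s) * Ψ u)) : ℂ)

variable {P : Measure Ω} {Z : ℝ → Ω → ℝ} {Ψ : ℝ → ℝ} {g : ℝ → ℝ} {B : ℝ}

namespace IsRegularLevy

theorem integral_exp (h : IsRegularLevy Z P Ψ) {s : ℝ} (hs : 0 ≤ s) (u : ℝ) :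
    ∫ ω, Complex.exp (Complex.I * (u * Z s ω : ℝ)) ∂P = (Real.exp (-(s * Ψ u)) : ℂ) := by
  have hinc := h.integral_exp_sub 0 s u le_rfl hs
  rw [sub_zero] at hinc
  rw [← hinc]
  refine integral_congr_ae ?_
  filter_upwards [h.start_zero] with ω hω
  rw [hω, sub_zero]

theorem charFun_map (h : IsRegularLevy Z P Ψ) {s : ℝ} (hs : 0 ≤ s) (u : ℝ) :
    charFun (P.map (Z s)) u = (Real.exp (-(s * Ψ u)) : ℂ) := by
  rw [charFun_apply_real, integral_map (h.measurable s).aemeasurable (by fun_prop),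
    ← h.integral_exp hs]
  push_cast
  simp_rw [mul_comm Complex.I]

theorem exp_neg_exponent (h : IsRegularLevy Z P Ψ) (u : ℝ) :
    Real.exp (-Ψ u) = (charFun (P.map (Z 1)) u).re := by
  rw [h.charFun_map zero_le_one, one_mul, Complex.ofReal_re]

theorem continuous_exponent [IsProbabilityMeasure P] (h : IsRegularLevy Z P Ψ) :
    Continuous Ψ := by
  have : IsProbabilityMeasure (P.map (Z 1)) :=
    Measure.isProbabilityMeasure_map (h.measurable 1).aemeasurable
  have hlog : Ψ = fun u => -Real.log (charFun (P.map (Z 1)) u).re := by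
    funext u
    rw [← h.exp_neg_exponent, Real.log_exp, neg_neg]
  rw [hlog]
  refine ((Complex.continuous_re.comp continuous_charFun).log fun u => ?_).neg
  exact (h.exp_neg_exponent u).symm.trans_ne (Real.exp_pos _).ne'

theorem exponent_nonneg [IsProbabilityMeasure P] (h : IsRegularLevy Z P Ψ) (u : ℝ) :
    0 ≤ Ψ u := by
  have : IsProbabilityMeasure (P.map (Z 1)) :=
    Measure.isProbabilityMeasure_map (h.measurable 1).aemeasurable
  have hle : Real.exp (-Ψ u) ≤ 1 := by
    rw [h.exp_neg_exponent]
    exact (Complex.re_le_norm _).trans (norm_charFun_le_one u)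
  simpa using hle

theorem exponent_neg (h : IsRegularLevy Z P Ψ) (u : ℝ) : Ψ (-u) = Ψ u := by
  have hexp : Real.exp (-Ψ (-u)) = Real.exp (-Ψ u) := by
    rw [h.exp_neg_exponent, h.exp_neg_exponent, charFun_neg, Complex.conj_re]
  simpa using hexp

theorem measurable_uncurry (h : IsRegularLevy Z P Ψ) : Measurable fun p : ℝ × Ω => Z p.1 p.2 :=
  measurable_uncurry_of_rightContinuous h.measurable h.rightContinuous

theorem measurable_path (h : IsRegularLevy Z P Ψ) (ω : Ω) : Measurable fun r => Z r ω :=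
  h.measurable_uncurry.comp measurable_prodMk_right

theorem pathAlgebra_le (h : IsRegularLevy Z P Ψ) (s : ℝ) : pathAlgebra Z s ≤ mΩ :=
  (measurable_pi_lambda _ fun _ => h.measurable _).comap_le

theorem integral_exp_sub_mul (h : IsRegularLevy Z P Ψ) {s τ : ℝ} (hs : 0 ≤ s) (hsτ : s ≤ τ)
    (u : ℝ) {V : Ω → ℂ} (hV : Measurable[pathAlgebra Z s] V) :
    ∫ ω, Complex.exp (Complex.I * (u * (Z τ ω - Z s ω) : ℝ)) * V ω ∂P =
      (Real.exp (-((τ - s) * Ψ u)) : ℂ) * ∫ ω, V ω ∂P := by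
  have hpast : IndepFun V (fun ω => Z τ ω - Z s ω) P := by
    have := h.indep s τ hs hsτ
    rw [IndepFun_iff_Indep] at this ⊢
    exact indep_of_indep_of_le_left this hV.comap_le
  have hexp : Measurable fun x : ℝ => Complex.exp (Complex.I * (u * x : ℝ)) := by fun_prop
  have hindep : IndepFun (fun ω => Complex.exp (Complex.I * (u * (Z τ ω - Z s ω) : ℝ))) V P :=
    hpast.symm.comp hexp measurable_id
  rw [hindep.integral_fun_mul_eq_mul_integral
    (hexp.comp ((h.measurable τ).sub (h.measurable s))).aestronglyMeasurable
    (hV.mono (h.pathAlgebra_le s) le_rfl).aestronglyMeasurable, h.integral_exp_sub s τ u hs hsτ]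

theorem rescale (h : IsRegularLevy Z P Ψ) {a : ℝ} (ha : 0 < a) :
    IsRegularLevy (fun r ω => Z (a ^ 2 * r) ω / a) P fun v => a ^ 2 * Ψ (v / a) where
  measurable s := (h.measurable _).div_const _
  rightContinuous ω s := by
    refine ((h.rightContinuous ω (a ^ 2 * s)).comp (t := Set.Ioi (a ^ 2 * s))
      (f := fun r => a ^ 2 * r) (by fun_prop) fun r hr => ?_).div_const _
    exact mul_lt_mul_of_pos_left (Set.mem_Ioi.1 hr) (by positivity)
  start_zero := by
    filter_upwards [h.start_zero] with ω hω
    simp [hω]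
  indep s τ hs hsτ := by
    have hZ := h.indep (a ^ 2 * s) (a ^ 2 * τ) (by positivity) (by gcongr)
    have hcomp := hZ.comp (φ := fun (x : Set.Iic (a ^ 2 * s) → ℝ) (r : Set.Iic s) =>
        x ⟨a ^ 2 * r, mul_le_mul_of_nonneg_left r.2 (sq_nonneg a)⟩ / a)
      (ψ := fun y : ℝ => y / a) (by fun_prop) (by fun_prop)
    simpa only [Function.comp_def, sub_div] using hcomp
  integral_exp_sub s τ u hs hsτ := by
    have hZ := h.integral_exp_sub (a ^ 2 * s) (a ^ 2 * τ) (u / a) (by positivity) (by gcongr)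
    have hu : ∀ ω, u * (Z (a ^ 2 * τ) ω / a - Z (a ^ 2 * s) ω / a) =
        u / a * (Z (a ^ 2 * τ) ω - Z (a ^ 2 * s) ω) := fun ω => by ring
    simp only [hu, hZ]
    congr 3
    ring

theorem intervalIntegrable_comp (h : IsRegularLevy Z P Ψ) (hg : Measurable g)
    (hB : ∀ y, |g y| ≤ B) (ω : Ω) (a b : ℝ) :
    IntervalIntegrable (fun r => g (Z r ω)) volume a b := by
  refine IntervalIntegrable.mono_fun (f := fun _ => B) intervalIntegrable_const
    (hg.comp (h.measurable_path ω)).aestronglyMeasurable (ae_of_all _ fun r => ?_)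
  simpa using (hB _).trans (le_abs_self B)

theorem continuous_occupation (h : IsRegularLevy Z P Ψ) (hg : Measurable g)
    (hB : ∀ y, |g y| ≤ B) (ω : Ω) : Continuous fun τ => occupation Z g τ ω :=
  intervalIntegral.continuous_primitive (fun a b => h.intervalIntegrable_comp hg hB ω a b) 0

theorem measurable_occupation_past (h : IsRegularLevy Z P Ψ) (hg : Measurable g) {s : ℝ}
    (hs : 0 ≤ s) : Measurable[pathAlgebra Z s] (occupation Z g s) := by
  have hstopped : occupation Z g s = fun ω => ∫ r in Set.Ioc 0 s, g (Z (min r s) ω) := by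
    funext ω
    rw [occupation, intervalIntegral.integral_of_le hs]
    exact setIntegral_congr_fun measurableSet_Ioc fun r hr => by simp only [min_eq_left hr.2]
  rw [hstopped]
  refine @measurable_integral_of_rightContinuous Ω (pathAlgebra Z s) (fun r ω => Z (min r s) ω)
    (fun r => measurable_eval_pathAlgebra Z (min_le_right r s)) (fun ω r => ?_) g hg (Set.Ioc 0 s)
  rcases lt_or_ge r s with hr | hr
  · refine (h.rightContinuous ω r).congr_of_eventuallyEq ?_ (by rw [min_eq_left hr.le])
    filter_upwards [nhdsWithin_le_nhds (Iio_mem_nhds hr)] with x hx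
    rw [min_eq_left (le_of_lt hx)]
  · refine (continuousWithinAt_const (b := Z s ω)).congr_of_eventuallyEq ?_
      (by rw [min_eq_right hr])
    filter_upwards [self_mem_nhdsWithin] with x hx
    rw [min_eq_right (hr.trans (le_of_lt hx))]

theorem measurable_occupation (h : IsRegularLevy Z P Ψ) (hg : Measurable g) (s : ℝ) :
    Measurable (occupation Z g s) :=
  (measurable_integral_of_rightContinuous h.measurable h.rightContinuous hg _).sub
    (measurable_integral_of_rightContinuous h.measurable h.rightContinuous hg _)

theorem measurable_uncurry_occupation (h : IsRegularLevy Z P Ψ) (hg : Measurable g)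
    (hB : ∀ y, |g y| ≤ B) : Measurable fun p : ℝ × Ω => occupation Z g p.1 p.2 :=
  measurable_uncurry_of_rightContinuous (h.measurable_occupation hg) fun ω _ =>
    (h.continuous_occupation hg hB ω).continuousWithinAt

theorem occupation_pow_succ (h : IsRegularLevy Z P Ψ) (hg : Continuous g)
    (hB : ∀ y, |g y| ≤ B) (k : ℕ) (τ : ℝ) (ω : Ω) :
    occupation Z g τ ω ^ (k + 1) =
      ((k : ℝ) + 1) * ∫ s in (0 : ℝ)..τ, g (Z s ω) * occupation Z g s ω ^ k := by
  have hcont := h.continuous_occupation hg.measurable hB ω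
  have hint := h.intervalIntegrable_comp hg.measurable hB ω
  have hderiv : ∀ x, HasDerivWithinAt (fun s => occupation Z g s ω) (g (Z x ω)) (Set.Ioi x) x :=
    fun x => (intervalIntegral.integral_hasDerivWithinAt_right (hint 0 x)
      (s := Set.Ici x) (t := Set.Ioi x)
      ⟨Set.univ, univ_mem,
        (hg.measurable.comp (h.measurable_path ω)).aestronglyMeasurable⟩
      (hg.continuousAt.comp_continuousWithinAt (h.rightContinuous ω x))).mono
        Set.Ioi_subset_Ici_self
  have hpow : ∀ x, HasDerivWithinAt (fun s => occupation Z g s ω ^ (k + 1))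
      (((k : ℝ) + 1) * (g (Z x ω) * occupation Z g x ω ^ k)) (Set.Ioi x) x := fun x => by
    refine ((hderiv x).fun_pow (k + 1)).congr_deriv ?_
    push_cast [Nat.add_sub_cancel]
    ring
  have hftc := intervalIntegral.integral_eq_sub_of_hasDeriv_right (a := 0) (b := τ)
    (hcont.pow (k + 1)).continuousOn (fun x _ => hpow x)
    (((hint 0 τ).mul_continuousOn (hcont.pow k).continuousOn).const_mul _)
  rw [← intervalIntegral.integral_const_mul, hftc]
  simp [occupation]

theorem exp_mul_occupation_pow_succ (h : IsRegularLevy Z P Ψ) (hg : Continuous g)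
    (hB : ∀ y, |g y| ≤ B) (k : ℕ) {τ : ℝ} (hτ : 0 ≤ τ) (u : ℝ) (ω : Ω) :
    Complex.exp (Complex.I * (u * Z τ ω : ℝ)) * (occupation Z g τ ω : ℂ) ^ (k + 1) =
      ((k : ℂ) + 1) * ∫ s in Set.Ioc 0 τ,
        Complex.exp (Complex.I * (u * (Z τ ω - Z s ω) : ℝ)) *
          (Complex.exp (Complex.I * (u * Z s ω : ℝ)) *
            ((g (Z s ω) : ℂ) * (occupation Z g s ω : ℂ) ^ k)) := by
  have hpow : (occupation Z g τ ω : ℂ) ^ (k + 1) = ((k : ℂ) + 1) *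
      ∫ s in Set.Ioc 0 τ, (g (Z s ω) : ℂ) * (occupation Z g s ω : ℂ) ^ k := by
    have := congrArg (Complex.ofReal) (h.occupation_pow_succ hg hB k τ ω)
    rw [intervalIntegral.integral_of_le hτ, Complex.ofReal_mul, ← integral_complex_ofReal] at this
    push_cast at this
    exact this
  have hsplit : ∀ s, Complex.exp (Complex.I * (u * Z τ ω : ℝ)) =
      Complex.exp (Complex.I * (u * (Z τ ω - Z s ω) : ℝ)) *
        Complex.exp (Complex.I * (u * Z s ω : ℝ)) := fun s => by
    rw [← Complex.exp_add, ← mul_add, ← Complex.ofReal_add, ← mul_add, sub_add_cancel]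
  rw [hpow, mul_left_comm, ← integral_const_mul]
  simp_rw [← mul_assoc, ← hsplit]

end IsRegularLevy

theorem integrable_prod_restrict_of_bound [IsFiniteMeasure P] {A : Set ℝ}
    (hA : MeasurableSet A) (hA' : volume A ≠ ∞) {C : ℝ} {F : Ω × ℝ → ℂ} (hF : Measurable F)
    (hb : ∀ ω, ∀ s ∈ A, ‖F (ω, s)‖ ≤ C) :
    Integrable F (P.prod (volume.restrict A)) := by
  have : IsFiniteMeasure (volume.restrict A) := ⟨by simpa using hA'.lt_top⟩
  refine Integrable.of_bound hF.aestronglyMeasurable C ?_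
  rw [← Measure.restrict_univ (μ := P), Measure.prod_restrict]
  filter_upwards [ae_restrict_mem (MeasurableSet.univ.prod hA)] with p hp
  exact hb p.1 p.2 hp.2

namespace IsRegularLevy

theorem integrable_exp_sub_mul_occupation_pow [IsFiniteMeasure P] (h : IsRegularLevy Z P Ψ)
    (hg : Continuous g) (hB : ∀ y, |g y| ≤ B) (k : ℕ) (τ u : ℝ) :
    Integrable (fun p : Ω × ℝ => Complex.exp (Complex.I * (u * (Z τ p.1 - Z p.2 p.1) : ℝ)) *
        (Complex.exp (Complex.I * (u * Z p.2 p.1 : ℝ)) *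
          ((g (Z p.2 p.1) : ℂ) * (occupation Z g p.2 p.1 : ℂ) ^ k)))
      (P.prod (volume.restrict (Set.Ioc 0 τ))) := by
  have hB0 : 0 ≤ B := (abs_nonneg _).trans (hB 0)
  refine integrable_prod_restrict_of_bound (C := B * (B * τ) ^ k) measurableSet_Ioc (by simp)
    ?_ fun ω s hs => ?_
  · have hZs : Measurable fun p : Ω × ℝ => Z p.2 p.1 := h.measurable_uncurry.comp measurable_swap
    have hZτ : Measurable fun p : Ω × ℝ => Z τ p.1 := (h.measurable τ).comp measurable_fst
    have hocc : Measurable fun p : Ω × ℝ => occupation Z g p.2 p.1 :=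
      (h.measurable_uncurry_occupation hg.measurable hB).comp measurable_swap
    have hgm := hg.measurable
    have hfun : Measurable fun q : ℝ × ℝ × ℝ => Complex.exp (Complex.I * (u * (q.1 - q.2.1) : ℝ)) *
        (Complex.exp (Complex.I * (u * q.2.1 : ℝ)) * ((g q.2.1 : ℂ) * (q.2.2 : ℂ) ^ k)) := by
      fun_prop
    exact hfun.comp (hZτ.prodMk (hZs.prodMk hocc))
  · simp only [norm_mul, norm_pow, mul_comm Complex.I, Complex.norm_exp_ofReal_mul_I, one_mul,
      Complex.norm_real, Real.norm_eq_abs]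
    gcongr
    · exact hB _
    · exact (abs_occupation_le hB hs.1.le ω).trans (by gcongr; exact hs.2)

theorem integral_exp_mul_occupation_pow_succ [IsFiniteMeasure P] (h : IsRegularLevy Z P Ψ)
    (hg : Continuous g) (hB : ∀ y, |g y| ≤ B) (k : ℕ) {τ : ℝ} (hτ : 0 ≤ τ) (u : ℝ) :
    ∫ ω, Complex.exp (Complex.I * (u * Z τ ω : ℝ)) * (occupation Z g τ ω : ℂ) ^ (k + 1) ∂P =
      ((k : ℂ) + 1) * ∫ s in Set.Ioc 0 τ, (Real.exp (-((τ - s) * Ψ u)) : ℂ) *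
        ∫ ω, Complex.exp (Complex.I * (u * Z s ω : ℝ)) *
          ((g (Z s ω) : ℂ) * (occupation Z g s ω : ℂ) ^ k) ∂P := by
  simp_rw [h.exp_mul_occupation_pow_succ hg hB k hτ u]
  rw [integral_const_mul, integral_integral_swap
    (h.integrable_exp_sub_mul_occupation_pow hg hB k τ u)]
  congr 1
  refine setIntegral_congr_fun measurableSet_Ioc fun s hs =>
    h.integral_exp_sub_mul hs.1.le hs.2 u ?_
  have hZ := measurable_eval_pathAlgebra Z (le_refl s)
  have hocc := h.measurable_occupation_past hg.measurable hs.1.le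
  have hgm := hg.measurable
  have hfun : Measurable fun q : ℝ × ℝ => Complex.exp (Complex.I * (u * q.1 : ℝ)) *
      ((g q.1 : ℂ) * (q.2 : ℂ) ^ k) := by fun_prop
  exact hfun.comp (hZ.prodMk hocc)

end IsRegularLevy

end RegularLevy

section SincKernel

/-- The inverse Fourier transform of the indicator of `[-δ, δ]`. -/
noncomputable def sincKernel (δ y : ℝ) : ℝ :=
  (2 * Real.pi)⁻¹ * ∫ x in -δ..δ, Real.cos (x * y)

theorem continuous_sincKernel (δ : ℝ) : Continuous (sincKernel δ) :=
  continuous_const.mul <| intervalIntegral.continuous_parametric_intervalIntegral_of_continuous'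
    (f := fun y x => Real.cos (x * y)) (by unfold Function.uncurry; fun_prop) _ _

theorem abs_sincKernel_le (δ y : ℝ) : |sincKernel δ y| ≤ (2 * Real.pi)⁻¹ * |δ - -δ| := by
  rw [sincKernel, abs_mul, abs_of_pos (by positivity : (0 : ℝ) < (2 * Real.pi)⁻¹)]
  refine mul_le_mul_of_nonneg_left ?_ (by positivity)
  have := intervalIntegral.norm_integral_le_of_norm_le_const (a := -δ) (b := δ) (C := 1)
    (f := fun x => Real.cos (x * y)) fun x _ => by simpa using Real.abs_cos_le_one _
  rwa [one_mul] at this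

theorem ofReal_sincKernel (δ y : ℝ) :
    (sincKernel δ y : ℂ) =
      ((2 * Real.pi)⁻¹ : ℝ) * ∫ x in -δ..δ, Complex.exp (Complex.I * (x * y : ℝ)) := by
  have heuler : ∀ x : ℝ, Complex.exp (Complex.I * (x * y : ℝ)) =
      (Real.cos (x * y) : ℂ) + (Real.sin (x * y) : ℂ) * Complex.I := fun x => by
    rw [mul_comm, Complex.exp_mul_I, Complex.ofReal_cos, Complex.ofReal_sin]
  have hodd : ∫ x in -δ..δ, Real.sin (x * y) = 0 := by
    have := intervalIntegral.integral_comp_neg (a := -δ) (b := δ) fun x => Real.sin (x * y)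
    simp only [neg_mul, Real.sin_neg, intervalIntegral.integral_neg, neg_neg] at this
    linarith
  simp_rw [sincKernel, heuler]
  rw [intervalIntegral.integral_add (Continuous.intervalIntegrable (by fun_prop) _ _)
    (Continuous.intervalIntegrable (by fun_prop) _ _), intervalIntegral.integral_mul_const,
    intervalIntegral.integral_ofReal, intervalIntegral.integral_ofReal, hodd]
  simp

theorem sincKernel_mul_div {a : ℝ} (ha : a ≠ 0) (δ y : ℝ) :
    sincKernel (a * δ) (y / a) = a * sincKernel δ y := by
  have hscale := intervalIntegral.integral_comp_mul_left (a := -δ) (b := δ)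
    (fun x => Real.cos (x * (y / a))) ha
  have hcancel : ∀ x : ℝ, a * x * (y / a) = x * y := fun x => by field_simp
  simp only [hcancel] at hscale
  rw [sincKernel, sincKernel, hscale, mul_neg, smul_eq_mul, mul_left_comm a,
    mul_inv_cancel_left₀ ha]

theorem occupation_rescale {Ω : Type*} (Z : ℝ → Ω → ℝ) {a : ℝ} (ha : a ≠ 0) (δ τ : ℝ) (ω : Ω) :
    occupation (fun r ω => Z (a ^ 2 * r) ω / a) (sincKernel (a * δ)) τ ω =
      a⁻¹ * occupation Z (sincKernel δ) (a ^ 2 * τ) ω := by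
  simp only [occupation, sincKernel_mul_div ha]
  rw [intervalIntegral.integral_const_mul, intervalIntegral.integral_comp_mul_left
    (fun r => sincKernel δ (Z r ω)) (pow_ne_zero 2 ha), mul_zero, smul_eq_mul]
  field_simp

theorem integral_exp_mul_sincKernel_mul {Ω : Type*} [MeasurableSpace Ω] {P : Measure Ω}
    [IsFiniteMeasure P] {Y : Ω → ℝ} (hY : Measurable Y) {δ : ℝ} (hδ : 0 ≤ δ) (u : ℝ) {V : Ω → ℂ}
    (hV : Measurable V) {C : ℝ} (hC : ∀ ω, ‖V ω‖ ≤ C) :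
    ∫ ω, Complex.exp (Complex.I * (u * Y ω : ℝ)) * ((sincKernel δ (Y ω) : ℂ) * V ω) ∂P =
      ((2 * Real.pi)⁻¹ : ℝ) * ∫ x in Set.Ioc (-δ) δ,
        ∫ ω, Complex.exp (Complex.I * ((u + x) * Y ω : ℝ)) * V ω ∂P := by
  have hint : Integrable (fun p : Ω × ℝ =>
      Complex.exp (Complex.I * ((u + p.2) * Y p.1 : ℝ)) * V p.1)
      (P.prod (volume.restrict (Set.Ioc (-δ) δ))) := by
    refine integrable_prod_restrict_of_bound (C := C) measurableSet_Ioc (by simp) (by fun_prop)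
      fun ω x _ => ?_
    simpa only [norm_mul, mul_comm Complex.I, Complex.norm_exp_ofReal_mul_I, one_mul] using hC ω
  rw [← integral_integral_swap hint, ← integral_const_mul]
  refine integral_congr_ae (ae_of_all _ fun ω => ?_)
  dsimp only
  rw [ofReal_sincKernel, intervalIntegral.integral_of_le (by linarith), integral_mul_const,
    mul_assoc, mul_left_comm, ← mul_assoc (Complex.exp _), ← integral_const_mul]
  congr 2
  refine integral_congr_ae (ae_of_all _ fun x => ?_)
  dsimp only
  rw [← Complex.exp_add]
  push_cast
  ring_nf

variable {Ω : Type*} [MeasurableSpace Ω] {P : Measure Ω} [IsProbabilityMeasure P]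
  {Z : ℝ → Ω → ℝ} {Ψ : ℝ → ℝ} {δ : ℝ}

namespace IsRegularLevy

theorem integral_exp_mul_sincKernel_mul_occupation_pow (h : IsRegularLevy Z P Ψ) (hδ : 0 ≤ δ)
    {k : ℕ} {s : ℝ} (hs : 0 ≤ s)
    (hmoment : ∀ v : ℝ, ∫ ω, Complex.exp (Complex.I * (v * Z s ω : ℝ)) *
        (occupation Z (sincKernel δ) s ω : ℂ) ^ k ∂P =
      ((k.factorial * (chainKernel Ψ (Set.Ioc (-δ) δ) k s v).toReal : ℝ) : ℂ)) (u : ℝ) :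
    ∫ ω, Complex.exp (Complex.I * (u * Z s ω : ℝ)) *
        ((sincKernel δ (Z s ω) : ℂ) * (occupation Z (sincKernel δ) s ω : ℂ) ^ k) ∂P =
      ((k.factorial * (chainMass Ψ (Set.Ioc (-δ) δ) k s u).toReal : ℝ) : ℂ) := by
  have hocc := h.measurable_occupation (continuous_sincKernel δ).measurable s
  have hbound : ∀ ω, ‖(occupation Z (sincKernel δ) s ω : ℂ) ^ k‖ ≤
      ((2 * Real.pi)⁻¹ * |δ - -δ| * s) ^ k := fun ω => by
    rw [norm_pow, Complex.norm_real, Real.norm_eq_abs]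
    gcongr
    exact abs_occupation_le (abs_sincKernel_le δ) hs ω
  rw [integral_exp_mul_sincKernel_mul (h.measurable s) hδ u (by fun_prop) hbound]
  have hm : Measurable fun x => chainKernel Ψ (Set.Ioc (-δ) δ) k s (u + x) :=
    (measurable_chainKernel_right h.continuous_exponent.measurable _ k s).comp
      (measurable_const_add u)
  simp_rw [hmoment]
  rw [integral_complex_ofReal, integral_const_mul, integral_toReal hm.aemeasurable
    (ae_of_all _ fun x => chainKernel_lt_top h.exponent_nonneg (by simp) k hs _), chainMass,
    ENNReal.toReal_mul, ENNReal.toReal_ofReal (by positivity)]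
  push_cast
  ring

theorem integral_exp_mul_occupation_pow (h : IsRegularLevy Z P Ψ) (hδ : 0 ≤ δ) (k : ℕ) {τ : ℝ}
    (hτ : 0 ≤ τ) (u : ℝ) :
    ∫ ω, Complex.exp (Complex.I * (u * Z τ ω : ℝ)) *
        (occupation Z (sincKernel δ) τ ω : ℂ) ^ k ∂P =
      ((k.factorial * (chainKernel Ψ (Set.Ioc (-δ) δ) k τ u).toReal : ℝ) : ℂ) := by
  induction k generalizing τ u with
  | zero => simpa [chainKernel, Real.exp_nonneg] using h.integral_exp hτ u
  | succ k ih =>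
    have hmass := measurable_chainMass_left h.continuous_exponent.measurable (Set.Ioc (-δ) δ) k u
    have hstep : ∀ s ∈ Set.Ioc 0 τ, (Real.exp (-((τ - s) * Ψ u)) : ℂ) *
        ∫ ω, Complex.exp (Complex.I * (u * Z s ω : ℝ)) *
          ((sincKernel δ (Z s ω) : ℂ) * (occupation Z (sincKernel δ) s ω : ℂ) ^ k) ∂P =
        ((k.factorial * (ENNReal.ofReal (Real.exp (-((τ - s) * Ψ u))) *
          chainMass Ψ (Set.Ioc (-δ) δ) k s u).toReal : ℝ) : ℂ) := fun s hs => by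
      rw [h.integral_exp_mul_sincKernel_mul_occupation_pow hδ hs.1.le (ih hs.1.le),
        ENNReal.toReal_mul, ENNReal.toReal_ofReal (Real.exp_pos _).le]
      push_cast
      ring
    rw [h.integral_exp_mul_occupation_pow_succ (continuous_sincKernel δ) (abs_sincKernel_le δ)
        k hτ u, setIntegral_congr_fun measurableSet_Ioc hstep, integral_complex_ofReal,
      integral_const_mul, integral_toReal (by fun_prop) ?_, ← chainKernel_succ,
      Nat.factorial_succ]
    · push_cast
      ring
    · filter_upwards [ae_restrict_mem measurableSet_Ioc] with s hs
      exact ENNReal.mul_lt_top ENNReal.ofReal_lt_top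
        (chainMass_lt_top h.exponent_nonneg (by simp) k hs.1.le u)

theorem integral_occupation_pow (h : IsRegularLevy Z P Ψ) (hδ : 0 ≤ δ) (k : ℕ) {τ : ℝ}
    (hτ : 0 ≤ τ) :
    ∫ ω, occupation Z (sincKernel δ) τ ω ^ k ∂P =
      k.factorial * (chainKernel Ψ (Set.Ioc (-δ) δ) k τ 0).toReal := by
  have := h.integral_exp_mul_occupation_pow hδ k hτ 0
  simp only [zero_mul, Complex.ofReal_zero, mul_zero, Complex.exp_zero, one_mul,
    ← Complex.ofReal_pow] at this
  rw [integral_complex_ofReal] at this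
  exact_mod_cast this

end IsRegularLevy

end SincKernel

section Laplace

theorem lintegral_exp_neg_mul_Ioi {q : ℝ} (hq : 0 ≤ q) :
    ∫⁻ s in Set.Ioi 0, ENNReal.ofReal (Real.exp (-(s * q))) = (ENNReal.ofReal q)⁻¹ := by
  rcases hq.eq_or_lt with rfl | hq
  · simp
  have hint : IntegrableOn (fun s : ℝ => Real.exp (-(s * q))) (Set.Ioi 0) := by
    simpa [mul_comm] using exp_neg_integrableOn_Ioi 0 hq
  rw [← ofReal_integral_eq_lintegral_ofReal hint (ae_of_all _ fun s => (Real.exp_pos _).le),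
    ← ENNReal.ofReal_inv_of_pos hq]
  congr 1
  simpa [mul_comm] using integral_exp_mul_Ioi (neg_lt_zero.2 hq) 0

theorem lintegral_exp_neg_sub_mul_Ici (s : ℝ) {q : ℝ} (hq : 0 ≤ q) :
    ∫⁻ r in Set.Ici s, ENNReal.ofReal (Real.exp (-((r - s) * q))) = (ENNReal.ofReal q)⁻¹ := by
  rw [← lintegral_exp_neg_mul_Ioi hq, setLIntegral_congr Ioi_ae_eq_Ici,
    ← lintegral_indicator measurableSet_Ici, ← lintegral_indicator measurableSet_Ici,
    ← lintegral_sub_right_eq_self ((Set.Ici 0).indicator _) s]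
  refine lintegral_congr fun r => ?_
  simp [Set.indicator_apply]

/-- The Laplace transform of Lebesgue measure on the time interval `(0, T]`. -/
noncomputable def truncLaplace (T q : ℝ) : ℝ≥0∞ :=
  ∫⁻ s in Set.Ioc 0 T, ENNReal.ofReal (Real.exp (-(s * q)))

theorem measurable_truncLaplace (T : ℝ) : Measurable (truncLaplace T) := by
  have hm : Measurable fun p : ℝ × ℝ => ENNReal.ofReal (Real.exp (-(p.2 * p.1))) := by fun_prop
  exact hm.lintegral_prod_right'

theorem truncLaplace_le_ofReal (T : ℝ) {q : ℝ} (hq : 0 ≤ q) :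
    truncLaplace T q ≤ ENNReal.ofReal T :=
  calc truncLaplace T q ≤ ∫⁻ _ in Set.Ioc 0 T, 1 :=
        setLIntegral_mono measurable_const fun s hs =>
          ENNReal.ofReal_le_one.2 (Real.exp_le_one_iff.2 (neg_nonpos.2 (mul_nonneg hs.1.le hq)))
    _ = ENNReal.ofReal T := by simp

theorem truncLaplace_le_inv (T : ℝ) {q : ℝ} (hq : 0 ≤ q) :
    truncLaplace T q ≤ (ENNReal.ofReal q)⁻¹ := by
  rw [← lintegral_exp_neg_mul_Ioi hq]
  exact lintegral_mono_set Set.Ioc_subset_Ioi_self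

theorem inv_sq_mul_truncLaplace_le {b q : ℝ} (hb : 1 ≤ b) (hq : 0 < q) (t : ℝ) :
    ENNReal.ofReal (b ^ 2)⁻¹ * truncLaplace (t ^ 2 * b ^ 2) q ≤
      ENNReal.ofReal ((t ^ 2 + 1) * (1 / (1 + q))) := by
  have hb2 : 1 ≤ b ^ 2 := one_le_pow₀ hb
  have hL : truncLaplace (t ^ 2 * b ^ 2) q ≤ ENNReal.ofReal (min (t ^ 2 * b ^ 2) q⁻¹) := by
    rw [ENNReal.ofReal_min, ENNReal.ofReal_inv_of_pos hq]
    exact le_min (truncLaplace_le_ofReal _ hq.le) (truncLaplace_le_inv _ hq.le)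
  refine (mul_le_mul_right hL _).trans ?_
  rw [← ENNReal.ofReal_mul (by positivity)]
  refine ENNReal.ofReal_le_ofReal ?_
  rw [mul_one_div, le_div_iff₀ (by positivity), mul_assoc, inv_mul_le_iff₀ (by positivity)]
  have htime := min_le_left (t ^ 2 * b ^ 2) q⁻¹
  have hfreq : min (t ^ 2 * b ^ 2) q⁻¹ * q ≤ 1 :=
    (mul_le_mul_of_nonneg_right (min_le_right _ _) hq.le).trans_eq (inv_mul_cancel₀ hq.ne')
  nlinarith

theorem tendsto_lintegral_truncLaplace {Ψ : ℝ → ℝ} (hΨ : Measurable Ψ)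
    (hpos : ∀ x, x ≠ 0 → 0 < Ψ x) (hint : Integrable fun x => 1 / (1 + Ψ x))
    {ι : Type*} {l : Filter ι} [l.IsCountablyGenerated] {a : ι → ℝ} (ha : Tendsto a l atTop)
    (t : ℝ) :
    Tendsto (fun i => ENNReal.ofReal (a i ^ 2)⁻¹ * ∫⁻ u, truncLaplace (t ^ 2 * a i ^ 2) (Ψ u))
      l (𝓝 0) := by
  have hm : ∀ T, Measurable fun u => truncLaplace T (Ψ u) := fun T =>
    (measurable_truncLaplace T).comp hΨ
  have hne : ∀ᵐ u : ℝ, u ≠ 0 := by simp [ae_iff]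
  simp_rw [← lintegral_const_mul _ (hm _)]
  rw [← lintegral_zero (α := ℝ) (μ := volume)]
  refine tendsto_lintegral_filter_of_dominated_convergence
    (fun u => ENNReal.ofReal ((t ^ 2 + 1) * (1 / (1 + Ψ u))))
    (Eventually.of_forall fun i => (hm _).const_mul _) ?_
    (hint.const_mul (t ^ 2 + 1)).lintegral_lt_top.ne ?_
  · filter_upwards [ha.eventually_ge_atTop 1] with i hi
    filter_upwards [hne] with u hu
    exact inv_sq_mul_truncLaplace_le hi (hpos u hu) t
  · filter_upwards [hne] with u hu
    have hinv : Tendsto (fun i => ENNReal.ofReal (a i ^ 2)⁻¹) l (𝓝 0) := by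
      simpa using ENNReal.tendsto_ofReal
        ((tendsto_pow_atTop two_ne_zero).comp ha).inv_tendsto_atTop
    have hlim := ENNReal.Tendsto.mul_const (b := (ENNReal.ofReal (Ψ u))⁻¹) hinv
      (Or.inr (by simpa using hpos u hu))
    rw [zero_mul] at hlim
    exact tendsto_of_tendsto_of_tendsto_of_le_of_le tendsto_const_nhds hlim (fun _ => zero_le)
      fun i => mul_le_mul_right (truncLaplace_le_inv _ (hpos u hu).le) _

end Laplace

section PhaseIntegral

/-- The function with spectral density `κ`: the unnormalized inverse Fourier transform in the
angular convention of `angularFourier`. -/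
noncomputable def phaseIntegral (κ : ℝ → ℂ) (y : ℝ) : ℂ :=
  ∫ x, κ x * Complex.exp (Complex.I * (x * y : ℝ))

theorem norm_mul_exp_I_mul_ofReal (c : ℂ) (x : ℝ) : ‖c * Complex.exp (Complex.I * x)‖ = ‖c‖ := by
  rw [norm_mul, mul_comm Complex.I, Complex.norm_exp_ofReal_mul_I, mul_one]

theorem integrable_mul_exp_I_mul_ofReal {κ : ℝ → ℂ} (hκ : Integrable κ) (y : ℝ) :
    Integrable fun x : ℝ => κ x * Complex.exp (Complex.I * (x * y : ℝ)) :=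
  hκ.mono (hκ.aestronglyMeasurable.mul (by fun_prop))
    (ae_of_all _ fun _ => (norm_mul_exp_I_mul_ofReal _ _).le)

theorem norm_phaseIntegral_le (κ : ℝ → ℂ) (y : ℝ) : ‖phaseIntegral κ y‖ ≤ ∫ x, ‖κ x‖ :=
  (norm_integral_le_integral_norm _).trans_eq <| by simp_rw [norm_mul_exp_I_mul_ofReal]

theorem measurable_phaseIntegral {κ : ℝ → ℂ} (hκ : Measurable κ) :
    Measurable (phaseIntegral κ) := by
  have hm : Measurable fun p : ℝ × ℝ => κ p.2 * Complex.exp (Complex.I * (p.2 * p.1 : ℝ)) := by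
    fun_prop
  exact hm.stronglyMeasurable.integral_prod_right'.measurable

end PhaseIntegral

section SecondMoment

theorem lintegral_enorm_integral_sq_le {𝕜 Ω α : Type*} [RCLike 𝕜] [MeasurableSpace Ω]
    [MeasurableSpace α] {P : Measure Ω} [IsFiniteMeasure P] {μ : Measure α} [SFinite μ]
    {F : Ω → α → 𝕜} (hF : Measurable (Function.uncurry F)) {b : α → ℝ} (hb : Integrable b μ)
    (hFb : ∀ ω p, ‖F ω p‖ ≤ b p) :
    ∫⁻ ω, ‖∫ p, F ω p ∂μ‖ₑ ^ 2 ∂P ≤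
      ∫⁻ z, ‖∫ ω, F ω z.1 * starRingEnd 𝕜 (F ω z.2) ∂P‖ₑ ∂(μ.prod μ) := by
  have hb0 : ∀ (_ : Ω) p, 0 ≤ b p := fun ω p => (norm_nonneg _).trans (hFb ω p)
  have hsq : ∀ ω, ((‖∫ p, F ω p ∂μ‖ ^ 2 : ℝ) : 𝕜) =
      ∫ z, F ω z.1 * starRingEnd 𝕜 (F ω z.2) ∂(μ.prod μ) := fun ω => by
    rw [integral_prod_mul (F ω) fun q => starRingEnd 𝕜 (F ω q), integral_conj, RCLike.mul_conj]
    push_cast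
    rfl
  have hint : Integrable (Function.uncurry fun ω (z : α × α) =>
      F ω z.1 * starRingEnd 𝕜 (F ω z.2)) (P.prod (μ.prod μ)) := by
    have h₁ : Measurable fun z : Ω × α × α => F z.1 z.2.1 :=
      hF.comp (measurable_fst.prodMk measurable_snd.fst)
    have h₂ : Measurable fun z : Ω × α × α => F z.1 z.2.2 :=
      hF.comp (measurable_fst.prodMk measurable_snd.snd)
    refine ((hb.mul_prod hb).comp_snd P).mono'
      (h₁.mul (RCLike.continuous_conj.measurable.comp h₂)).aestronglyMeasurable
      (ae_of_all _ fun z => ?_)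
    simp only [Function.uncurry, norm_mul, RCLike.norm_conj]
    exact mul_le_mul (hFb _ _) (hFb _ _) (norm_nonneg _) (hb0 z.1 _)
  have hsqi : Integrable (fun ω => ‖∫ p, F ω p ∂μ‖ ^ 2) P := by
    have hre := hint.integral_prod_left.re
    simp only [Function.uncurry, ← hsq, RCLike.ofReal_re] at hre
    exact hre
  calc ∫⁻ ω, ‖∫ p, F ω p ∂μ‖ₑ ^ 2 ∂P
      = ENNReal.ofReal (∫ ω, ‖∫ p, F ω p ∂μ‖ ^ 2 ∂P) := by
        rw [ofReal_integral_eq_lintegral_ofReal hsqi (ae_of_all _ fun ω => by positivity)]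
        simp_rw [ENNReal.ofReal_pow (norm_nonneg _), ofReal_norm]
    _ = ‖∫ ω, ∫ z, F ω z.1 * starRingEnd 𝕜 (F ω z.2) ∂(μ.prod μ) ∂P‖ₑ := by
        simp_rw [← hsq]
        rw [integral_ofReal, ← ofReal_norm, RCLike.norm_ofReal,
          abs_of_nonneg (integral_nonneg fun ω => by positivity)]
    _ = ‖∫ z, ∫ ω, F ω z.1 * starRingEnd 𝕜 (F ω z.2) ∂P ∂(μ.prod μ)‖ₑ := by
        rw [integral_integral_swap hint]
    _ ≤ _ := enorm_integral_le_lintegral_enorm _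

/-- The modulus of the joint characteristic function of the process at two (time, frequency) pairs
`p` and `q` with `p.1 ≤ q.1`, extended by zero to the other order of times. -/
noncomputable def twoTimeKernel (Ψ : ℝ → ℝ) (p q : ℝ × ℝ) : ℝ≥0∞ :=
  (Set.Ici p.1).indicator (fun r => ENNReal.ofReal (Real.exp (-(p.1 * Ψ (p.2 - q.2)))) *
    ENNReal.ofReal (Real.exp (-((r - p.1) * Ψ q.2)))) q.1

theorem measurable_twoTimeKernel {Ψ : ℝ → ℝ} (hΨ : Measurable Ψ) :
    Measurable (Function.uncurry (twoTimeKernel Ψ)) := by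
  have hm : Measurable fun z : (ℝ × ℝ) × (ℝ × ℝ) =>
      ENNReal.ofReal (Real.exp (-(z.1.1 * Ψ (z.1.2 - z.2.2)))) *
        ENNReal.ofReal (Real.exp (-((z.2.1 - z.1.1) * Ψ z.2.2))) := by fun_prop
  exact hm.indicator (s := {z | z.1.1 ≤ z.2.1})
    (measurableSet_le (f := fun z : (ℝ × ℝ) × (ℝ × ℝ) => z.1.1) (g := fun z => z.2.1)
      (by fun_prop) (by fun_prop))

theorem lintegral_twoTimeKernel_time_le {Ψ : ℝ → ℝ} (hΨ0 : ∀ x, 0 ≤ Ψ x) (A : Set ℝ)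
    (p : ℝ × ℝ) (y : ℝ) :
    ∫⁻ r in A, twoTimeKernel Ψ p (r, y) ≤
      ENNReal.ofReal (Real.exp (-(p.1 * Ψ (p.2 - y)))) * (ENNReal.ofReal (Ψ y))⁻¹ := by
  refine (setLIntegral_le_lintegral _ _).trans_eq ?_
  simp only [twoTimeKernel]
  rw [lintegral_indicator measurableSet_Ici, lintegral_const_mul _ (by fun_prop),
    lintegral_exp_neg_sub_mul_Ici _ (hΨ0 y)]

theorem lintegral_mul_twoTimeKernel_le {Ψ : ℝ → ℝ} (hΨ : Measurable Ψ) (hΨ0 : ∀ x, 0 ≤ Ψ x)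
    {η : ℝ → ℝ≥0∞} (hη : Measurable η) {A : Set ℝ} (p : ℝ × ℝ) :
    ∫⁻ q, η q.2 * twoTimeKernel Ψ p q ∂((volume.restrict A).prod volume) ≤
      ∫⁻ y, η y * (ENNReal.ofReal (Ψ y))⁻¹ * ENNReal.ofReal (Real.exp (-(p.1 * Ψ (p.2 - y)))) := by
  have hk : Measurable fun q : ℝ × ℝ => twoTimeKernel Ψ p q :=
    (measurable_twoTimeKernel hΨ).comp measurable_prodMk_left
  rw [lintegral_prod_symm _ (by fun_prop)]
  refine lintegral_mono fun y => ?_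
  have hky : Measurable fun r : ℝ => twoTimeKernel Ψ p (r, y) := hk.comp measurable_prodMk_right
  dsimp only
  rw [lintegral_const_mul _ hky, mul_assoc,
    mul_comm (ENNReal.ofReal (Ψ y))⁻¹]
  exact mul_le_mul_right (lintegral_twoTimeKernel_time_le hΨ0 A p y) _

theorem lintegral_twoTimeKernel_le {Ψ : ℝ → ℝ} (hΨ : Measurable Ψ) (hΨ0 : ∀ x, 0 ≤ Ψ x)
    {η : ℝ → ℝ≥0∞} (hη : Measurable η) (T : ℝ) :
    ∫⁻ z, η z.1.2 * η z.2.2 * twoTimeKernel Ψ z.1 z.2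
        ∂(((volume.restrict (Set.Ioc 0 T)).prod volume).prod
          ((volume.restrict (Set.Ioc 0 T)).prod volume)) ≤
      ∫⁻ y, η y * (ENNReal.ofReal (Ψ y))⁻¹ * ∫⁻ x, η x * truncLaplace T (Ψ (x - y)) := by
  have hk := measurable_twoTimeKernel hΨ
  have hL := measurable_truncLaplace T
  rw [lintegral_prod _ (by fun_prop)]
  calc ∫⁻ p, ∫⁻ q, η p.2 * η q.2 * twoTimeKernel Ψ p q
          ∂((volume.restrict (Set.Ioc 0 T)).prod volume)
        ∂((volume.restrict (Set.Ioc 0 T)).prod volume)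
      ≤ ∫⁻ p, (∫⁻ y, η p.2 * (η y * (ENNReal.ofReal (Ψ y))⁻¹ *
            ENNReal.ofReal (Real.exp (-(p.1 * Ψ (p.2 - y))))))
          ∂((volume.restrict (Set.Ioc 0 T)).prod volume) := by
        refine lintegral_mono fun p => ?_
        simp_rw [mul_assoc (η p.2)]
        rw [lintegral_const_mul _ (by fun_prop), lintegral_const_mul _ (by fun_prop)]
        exact mul_le_mul_right (lintegral_mul_twoTimeKernel_le hΨ hΨ0 hη p) _
    _ = ∫⁻ y, (∫⁻ p, η p.2 * (η y * (ENNReal.ofReal (Ψ y))⁻¹ *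
            ENNReal.ofReal (Real.exp (-(p.1 * Ψ (p.2 - y)))))
          ∂((volume.restrict (Set.Ioc 0 T)).prod volume)) :=
        lintegral_lintegral_swap (Measurable.aemeasurable (by fun_prop))
    _ = _ := by
        refine lintegral_congr fun y => ?_
        rw [lintegral_prod_symm _ (Measurable.aemeasurable (by fun_prop)),
          ← lintegral_const_mul _ (by fun_prop)]
        refine lintegral_congr fun x => ?_
        simp_rw [← mul_assoc]
        rw [lintegral_const_mul _ (by fun_prop), truncLaplace]
        ring

namespace IsRegularLevy

variable {Ω : Type*} [MeasurableSpace Ω] {P : Measure Ω} {Z : ℝ → Ω → ℝ} {Ψ : ℝ → ℝ}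

theorem enorm_integral_exp_sub_eq (h : IsRegularLevy Z P Ψ) {p q : ℝ × ℝ} (hp : 0 ≤ p.1)
    (hpq : p.1 ≤ q.1) :
    ‖∫ ω, Complex.exp (Complex.I * (p.2 * Z p.1 ω - q.2 * Z q.1 ω : ℝ)) ∂P‖ₑ =
      twoTimeKernel Ψ p q := by
  have hsplit : ∀ ω, Complex.exp (Complex.I * (p.2 * Z p.1 ω - q.2 * Z q.1 ω : ℝ)) =
      Complex.exp (Complex.I * (-q.2 * (Z q.1 ω - Z p.1 ω) : ℝ)) *
        Complex.exp (Complex.I * ((p.2 - q.2) * Z p.1 ω : ℝ)) := fun ω => by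
    rw [← Complex.exp_add, ← mul_add, ← Complex.ofReal_add]
    congr 3
    ring
  have hexp : Measurable fun x : ℝ => Complex.exp (Complex.I * ((p.2 - q.2) * x : ℝ)) := by
    fun_prop
  simp_rw [hsplit]
  rw [h.integral_exp_sub_mul hp hpq (-q.2)
    (V := fun ω => Complex.exp (Complex.I * ((p.2 - q.2) * Z p.1 ω : ℝ)))
    (hexp.comp (measurable_eval_pathAlgebra Z le_rfl)), h.integral_exp hp, h.exponent_neg,
    twoTimeKernel, Set.indicator_of_mem (Set.mem_Ici.2 hpq), enorm_mul, mul_comm]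
  simp only [← ofReal_norm, Complex.norm_real, Real.norm_of_nonneg (Real.exp_pos _).le]

theorem enorm_integral_exp_sub_le (h : IsRegularLevy Z P Ψ) {p q : ℝ × ℝ} (hp : 0 ≤ p.1)
    (hq : 0 ≤ q.1) :
    ‖∫ ω, Complex.exp (Complex.I * (p.2 * Z p.1 ω - q.2 * Z q.1 ω : ℝ)) ∂P‖ₑ ≤
      twoTimeKernel Ψ p q + twoTimeKernel Ψ q p := by
  rcases le_total p.1 q.1 with hpq | hqp
  · exact le_add_right (h.enorm_integral_exp_sub_eq hp hpq).le
  · refine le_add_left (le_of_eq ?_)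
    rw [← h.enorm_integral_exp_sub_eq hq hqp, ← RCLike.enorm_conj, ← integral_conj]
    simp_rw [← Complex.exp_conj, map_mul, Complex.conj_I, Complex.conj_ofReal, neg_mul, ← mul_neg,
      ← Complex.ofReal_neg, neg_sub]

theorem measurable_phaseIntegral_path (h : IsRegularLevy Z P Ψ) {κ : ℝ → ℂ} (hκ : Measurable κ) :
    Measurable fun p : Ω × ℝ => phaseIntegral κ (Z p.2 p.1) :=
  (measurable_phaseIntegral hκ).comp (h.measurable_uncurry.comp measurable_swap)

theorem measurable_spectral_path (h : IsRegularLevy Z P Ψ) {κ : ℝ → ℂ} (hκ : Measurable κ) :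
    Measurable (Function.uncurry fun ω (p : ℝ × ℝ) =>
      κ p.2 * Complex.exp (Complex.I * (p.2 * Z p.1 ω : ℝ))) := by
  have hZ : Measurable fun z : Ω × (ℝ × ℝ) => Z z.2.1 z.1 :=
    h.measurable_uncurry.comp (measurable_snd.fst.prodMk measurable_fst)
  have hfun : Measurable fun q : ℝ × ℝ => κ q.1 * Complex.exp (Complex.I * (q.1 * q.2 : ℝ)) := by
    fun_prop
  exact hfun.comp (measurable_snd.snd.prodMk hZ)

theorem enorm_integral_spectral_mul_conj_le (h : IsRegularLevy Z P Ψ) (κ : ℝ → ℂ) {p q : ℝ × ℝ}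
    (hp : 0 ≤ p.1) (hq : 0 ≤ q.1) :
    ‖∫ ω, κ p.2 * Complex.exp (Complex.I * (p.2 * Z p.1 ω : ℝ)) *
        starRingEnd ℂ (κ q.2 * Complex.exp (Complex.I * (q.2 * Z q.1 ω : ℝ))) ∂P‖ₑ ≤
      ‖κ p.2‖ₑ * ‖κ q.2‖ₑ * (twoTimeKernel Ψ p q + twoTimeKernel Ψ q p) := by
  have hfactor : ∀ ω, κ p.2 * Complex.exp (Complex.I * (p.2 * Z p.1 ω : ℝ)) *
      starRingEnd ℂ (κ q.2 * Complex.exp (Complex.I * (q.2 * Z q.1 ω : ℝ))) =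
      κ p.2 * starRingEnd ℂ (κ q.2) *
        Complex.exp (Complex.I * (p.2 * Z p.1 ω - q.2 * Z q.1 ω : ℝ)) := fun ω => by
    rw [map_mul, ← Complex.exp_conj, map_mul, Complex.conj_I, Complex.conj_ofReal,
      Complex.ofReal_sub, mul_sub, sub_eq_add_neg, Complex.exp_add]
    ring_nf
  simp_rw [hfactor]
  rw [integral_const_mul, enorm_mul, enorm_mul, RCLike.enorm_conj]
  exact mul_le_mul_right (h.enorm_integral_exp_sub_le hp hq) _

theorem setIntegral_phaseIntegral_eq (h : IsRegularLevy Z P Ψ) {κ : ℝ → ℂ} (hκ : Measurable κ)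
    (hκi : Integrable κ) (T : ℝ) (ω : Ω) :
    ∫ s in Set.Ioc 0 T, phaseIntegral κ (Z s ω) =
      ∫ p : ℝ × ℝ, κ p.2 * Complex.exp (Complex.I * (p.2 * Z p.1 ω : ℝ))
        ∂((volume.restrict (Set.Ioc 0 T)).prod volume) := by
  rw [integral_prod]
  · rfl
  · exact (hκi.comp_snd _).mono
      ((h.measurable_spectral_path hκ).comp measurable_prodMk_left).aestronglyMeasurable
      (ae_of_all _ fun p => (norm_mul_exp_I_mul_ofReal _ _).le)

theorem lintegral_enorm_setIntegral_phaseIntegral_sq_le [IsProbabilityMeasure P]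
    (h : IsRegularLevy Z P Ψ) {κ : ℝ → ℂ} (hκ : Measurable κ) (hκi : Integrable κ) (T : ℝ) :
    ∫⁻ ω, ‖∫ s in Set.Ioc 0 T, phaseIntegral κ (Z s ω)‖ₑ ^ 2 ∂P ≤
      2 * ∫⁻ y, ‖κ y‖ₑ * (ENNReal.ofReal (Ψ y))⁻¹ *
        ∫⁻ x, ‖κ x‖ₑ * truncLaplace T (Ψ (x - y)) := by
  set μ : Measure (ℝ × ℝ) := (volume.restrict (Set.Ioc 0 T)).prod volume
  have hpos : ∀ᵐ p ∂μ, 0 ≤ p.1 := by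
    refine Measure.quasiMeasurePreserving_fst.ae (p := fun s => 0 ≤ s) ?_
    filter_upwards [ae_restrict_mem measurableSet_Ioc] with s hs using hs.1.le
  have hk := measurable_twoTimeKernel h.continuous_exponent.measurable
  have hk' : Measurable fun z : (ℝ × ℝ) × (ℝ × ℝ) => twoTimeKernel Ψ z.1 z.2 := hk
  have hκe := hκ.enorm
  simp_rw [h.setIntegral_phaseIntegral_eq hκ hκi]
  refine (lintegral_enorm_integral_sq_le (h.measurable_spectral_path hκ) (hκi.norm.comp_snd _)
    fun ω p => (norm_mul_exp_I_mul_ofReal _ _).le).trans ?_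
  calc _ ≤ ∫⁻ z, (‖κ z.1.2‖ₑ * ‖κ z.2.2‖ₑ * twoTimeKernel Ψ z.1 z.2 +
          ‖κ z.2.2‖ₑ * ‖κ z.1.2‖ₑ * twoTimeKernel Ψ z.2 z.1) ∂(μ.prod μ) := by
        refine lintegral_mono_ae ?_
        filter_upwards [Measure.quasiMeasurePreserving_fst.ae hpos,
          Measure.quasiMeasurePreserving_snd.ae hpos] with z h₁ h₂
        rw [mul_comm ‖κ z.2.2‖ₑ, ← mul_add]
        exact h.enorm_integral_spectral_mul_conj_le κ h₁ h₂
    _ = 2 * ∫⁻ z, ‖κ z.1.2‖ₑ * ‖κ z.2.2‖ₑ * twoTimeKernel Ψ z.1 z.2 ∂(μ.prod μ) := by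
        rw [lintegral_add_left (by fun_prop), two_mul]
        congr 1
        exact lintegral_prod_swap fun z => ‖κ z.1.2‖ₑ * ‖κ z.2.2‖ₑ * twoTimeKernel Ψ z.1 z.2
    _ ≤ _ := mul_le_mul_right (lintegral_twoTimeKernel_le
        h.continuous_exponent.measurable h.exponent_nonneg hκe T) _

theorem tendsto_lintegral_enorm_setIntegral_phaseIntegral_sq [IsProbabilityMeasure P]
    (h : IsRegularLevy Z P Ψ) (hpos : ∀ x, x ≠ 0 → 0 < Ψ x)
    (hint : Integrable fun x => 1 / (1 + Ψ x)) {κ : ℝ → ℂ} (hκ : Measurable κ)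
    (hκi : Integrable κ) {C : ℝ} (hC : ∀ x, ‖κ x‖ ≤ C)
    (hκΨ : ∫⁻ y, ‖κ y‖ₑ * (ENNReal.ofReal (Ψ y))⁻¹ ≠ ∞)
    {ι : Type*} {l : Filter ι} [l.IsCountablyGenerated] {a : ι → ℝ} (ha : Tendsto a l atTop)
    (t : ℝ) :
    Tendsto (fun i => ∫⁻ ω, ‖(a i : ℂ)⁻¹ *
      ∫ s in Set.Ioc 0 (t ^ 2 * a i ^ 2), phaseIntegral κ (Z s ω)‖ₑ ^ 2 ∂P) l (𝓝 0) := by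
  have hΨm := h.continuous_exponent.measurable
  have hlim := ENNReal.Tendsto.const_mul
    (a := 2 * (ENNReal.ofReal C * ∫⁻ y, ‖κ y‖ₑ * (ENNReal.ofReal (Ψ y))⁻¹))
    (tendsto_lintegral_truncLaplace hΨm hpos hint ha t) (Or.inr (by finiteness))
  rw [mul_zero] at hlim
  refine tendsto_of_tendsto_of_tendsto_of_le_of_le' tendsto_const_nhds hlim
    (Eventually.of_forall fun _ => zero_le) ?_
  filter_upwards [ha.eventually_gt_atTop 0] with i hi
  set T := t ^ 2 * a i ^ 2
  have hscale : ‖(a i : ℂ)⁻¹‖ₑ ^ 2 = ENNReal.ofReal (a i ^ 2)⁻¹ := by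
    rw [← ofReal_norm, ← ENNReal.ofReal_pow (norm_nonneg _), norm_inv, Complex.norm_real,
      Real.norm_of_nonneg hi.le, inv_pow]
  have htranslate : ∀ y, ∫⁻ x, ‖κ x‖ₑ * truncLaplace T (Ψ (x - y)) ≤
      ENNReal.ofReal C * ∫⁻ x, truncLaplace T (Ψ x) := fun y => by
    rw [← lintegral_sub_right_eq_self (fun x => truncLaplace T (Ψ x)) y,
      ← lintegral_const_mul' _ _ ENNReal.ofReal_ne_top]
    refine lintegral_mono fun x => mul_le_mul_left ?_ _
    rw [← ofReal_norm]
    exact ENNReal.ofReal_le_ofReal (hC x)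
  simp_rw [enorm_mul, mul_pow]
  rw [lintegral_const_mul' _ _ (by finiteness), hscale]
  calc _ ≤ ENNReal.ofReal (a i ^ 2)⁻¹ * (2 * ∫⁻ y, ‖κ y‖ₑ * (ENNReal.ofReal (Ψ y))⁻¹ *
        (ENNReal.ofReal C * ∫⁻ x, truncLaplace T (Ψ x))) := by
        gcongr
        refine (h.lintegral_enorm_setIntegral_phaseIntegral_sq_le hκ hκi _).trans ?_
        gcongr with y
        exact htranslate y
    _ = _ := by
        rw [lintegral_mul_const _ (by fun_prop)]
        ring

end IsRegularLevy

end SecondMoment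

section FourierInversion

open FourierTransform SchwartzMap ContDiff

section

variable {V F : Type*} [NormedAddCommGroup V] [InnerProductSpace ℝ V] [FiniteDimensional ℝ V]
  [MeasurableSpace V] [BorelSpace V] [NormedAddCommGroup F] [NormedSpace ℂ F]
  [CompleteSpace F] {f : V → F}

theorem integral_fourier_smul_eq_integral_smul_fourier {g : V → ℂ} (hg : Integrable g)
    (hf : Integrable f) : ∫ x, 𝓕 g x • f x = ∫ x, g x • 𝓕 f x := by
  have hflip : (innerₗ V).flip = innerₗ V := flip_innerₗ V
  have := VectorFourier.integral_fourierIntegral_smul_eq_flip (L := innerₗ V)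
    Real.continuous_fourierChar continuous_inner hg hf
  rwa [hflip] at this

theorem integral_fourierInv_smul_eq_integral_smul_fourierInv {g : V → ℂ} (hg : Integrable g)
    (hf : Integrable f) : ∫ x, 𝓕⁻ g x • f x = ∫ x, g x • 𝓕⁻ f x := by
  have hflip : (-innerₗ V).flip = -innerₗ V := by
    ext x y
    simp [real_inner_comm]
  have := VectorFourier.integral_fourierIntegral_smul_eq_flip (L := -innerₗ V)
    Real.continuous_fourierChar continuous_inner.neg hg hf
  rwa [hflip] at this

theorem integral_smul_fourierInv_fourier (g : 𝓢(V, ℂ)) (hf : Integrable f)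
    (hf' : Integrable (𝓕 f)) : ∫ x, g x • 𝓕⁻ (𝓕 f) x = ∫ x, g x • f x :=
  calc ∫ x, g x • 𝓕⁻ (𝓕 f) x
      = ∫ x, (𝓕⁻ g) x • 𝓕 f x := by
        rw [fourierInv_coe, integral_fourierInv_smul_eq_integral_smul_fourierInv g.integrable hf']
    _ = ∫ x, 𝓕 ((𝓕⁻ g : 𝓢(V, ℂ)) : V → ℂ) x • f x :=
        (integral_fourier_smul_eq_integral_smul_fourier (𝓕⁻ g).integrable hf).symm
    _ = ∫ x, g x • f x := by rw [← fourier_coe, FourierTransform.fourier_fourierInv_eq]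

theorem ae_eq_fourierInv_fourier (hf : Integrable f) (hf' : Integrable (𝓕 f)) :
    f =ᵐ[volume] 𝓕⁻ (𝓕 f) := by
  have hcont : Continuous (𝓕⁻ (𝓕 f)) :=
    VectorFourier.fourierIntegral_continuous Real.continuous_fourierChar
      (L := -innerₗ V) continuous_inner.neg hf'
  refine ae_eq_of_integral_contDiff_smul_eq hf.locallyIntegrable hcont.locallyIntegrable
    fun g hg hgs => ?_
  have hGs : HasCompactSupport fun x => (g x : ℂ) := hgs.comp_left Complex.ofReal_zero
  have hGd : ContDiff ℝ ∞ fun x => (g x : ℂ) := Complex.ofRealCLM.contDiff.comp hg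
  exact (integral_smul_fourierInv_fourier (hGs.toSchwartzMap hGd) hf hf').symm

end

theorem fourier_eq_angularFourier (f : ℝ → ℂ) (ξ : ℝ) :
    𝓕 f ξ = angularFourier f (2 * Real.pi * ξ) := by
  rw [Real.fourier_eq', angularFourier]
  refine integral_congr_ae (ae_of_all _ fun y => ?_)
  simp only [smul_eq_mul, RCLike.inner_apply, conj_trivial]
  congr 2
  push_cast
  ring

theorem fourierInv_fourier_eq_phaseIntegral (f : ℝ → ℂ) (y : ℝ) :
    𝓕⁻ (𝓕 f) y = phaseIntegral (fun x => ((2 * Real.pi : ℝ) : ℂ)⁻¹ * angularFourier f x) y := by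
  have hscale := Measure.integral_comp_mul_left (fun x : ℝ => ((2 * Real.pi : ℝ) : ℂ)⁻¹ *
    angularFourier f x * Complex.exp (Complex.I * (x * y : ℝ))) (2 * Real.pi)
  rw [abs_of_pos (by positivity), eq_inv_smul_iff₀ (by positivity), ← integral_smul] at hscale
  rw [phaseIntegral, ← hscale, Real.fourierInv_eq']
  refine integral_congr_ae (ae_of_all _ fun x => ?_)
  have hpi : ((2 * Real.pi : ℝ) : ℂ) ≠ 0 := Complex.ofReal_ne_zero.2 (by positivity)
  simp only [smul_eq_mul, fourier_eq_angularFourier, Complex.real_smul, RCLike.inner_apply,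
    conj_trivial]
  rw [mul_assoc _ (angularFourier f _), mul_inv_cancel_left₀ hpi, mul_comm, mul_comm Complex.I,
    mul_comm y, ← mul_assoc (2 * Real.pi)]

theorem ae_eq_phaseIntegral_angularFourier {f : ℝ → ℂ} (hf : Integrable f)
    (hf' : Integrable (angularFourier f)) :
    f =ᵐ[volume] phaseIntegral fun x => ((2 * Real.pi : ℝ) : ℂ)⁻¹ * angularFourier f x := by
  have hFf : Integrable (𝓕 f) := by
    rw [funext (fourier_eq_angularFourier f)]
    exact hf'.comp_mul_left' (by positivity)
  rw [← funext (fourierInv_fourier_eq_phaseIntegral f)]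
  exact ae_eq_fourierInv_fourier hf hFf

theorem norm_angularFourier_le (f : ℝ → ℂ) (x : ℝ) : ‖angularFourier f x‖ ≤ ∫ y, ‖f y‖ := by
  refine (norm_integral_le_integral_norm _).trans_eq (integral_congr_ae (ae_of_all _ fun y => ?_))
  have hphase : -(Complex.I * x * y) = ((-(x * y) : ℝ) : ℂ) * Complex.I := by
    push_cast
    ring
  simp only [norm_mul, hphase, Complex.norm_exp_ofReal_mul_I, one_mul]

theorem measurable_angularFourier {f : ℝ → ℂ} (hf : AEStronglyMeasurable f) :
    Measurable (angularFourier f) := by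
  obtain ⟨g, hg, hfg⟩ := hf
  have hgm := hg.measurable
  have hfg' : angularFourier f = angularFourier g :=
    funext fun x => integral_congr_ae (hfg.mono fun y hy => by simp only [hy])
  have hm : Measurable fun p : ℝ × ℝ => Complex.exp (-(Complex.I * p.1 * p.2)) * g p.2 := by
    fun_prop
  rw [hfg']
  exact hm.stronglyMeasurable.integral_prod_right'.measurable

end FourierInversion

section AbsoluteContinuity

theorem measure_le_of_forall_closedBall_le {α : Type*} [MetricSpace α] [SecondCountableTopology α]
    [MeasurableSpace α] [BorelSpace α] [HasBesicovitchCovering α] {μ ν : Measure α} [SFinite μ]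
    [IsLocallyFiniteMeasure ν]
    (h : ∀ x r, 0 < r → μ (Metric.closedBall x r) ≤ ν (Metric.closedBall x r)) : μ ≤ ν :=
  Measure.le_intro fun s _ _ => (Besicovitch.vitaliFamily μ).measure_le_of_frequently_le ν .rfl s
    fun x _ => (Besicovitch.tendsto_filterAt μ x).frequently
      ((eventually_mem_nhdsWithin (a := (0 : ℝ)) (s := Set.Ioi 0)).mono (h x)).frequently

theorem integral_charFun_comm {E : Type*} [NormedAddCommGroup E] [InnerProductSpace ℝ E]
    [SecondCountableTopology E] [MeasurableSpace E] [BorelSpace E] (μ ν : Measure E)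
    [IsFiniteMeasure μ] [IsFiniteMeasure ν] :
    ∫ x, charFun μ x ∂ν = ∫ y, charFun ν y ∂μ := by
  simp only [charFun_apply]
  rw [integral_integral_swap]
  · simp_rw [real_inner_comm]
  · refine Integrable.of_bound (Continuous.aestronglyMeasurable (by fun_prop)) 1
      (ae_of_all _ fun p => ?_)
    exact (Complex.norm_exp_ofReal_mul_I _).le

variable {μ : Measure ℝ}

theorem norm_integral_charFun_gaussianReal_le (h : Integrable (charFun μ)) {v : ℝ≥0}
    (hv : v ≠ 0) :
    ‖∫ x, charFun μ x ∂gaussianReal 0 v‖ ≤ (√(2 * Real.pi * v))⁻¹ * ∫ x, ‖charFun μ x‖ := by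
  rw [integral_gaussianReal_eq_integral_smul hv, ← integral_const_mul]
  refine norm_integral_le_of_norm_le (h.norm.const_mul _) (ae_of_all _ fun x => ?_)
  rw [norm_smul, Real.norm_of_nonneg (gaussianPDFReal_nonneg _ _ _), gaussianPDFReal]
  refine mul_le_mul_of_nonneg_right (mul_le_of_le_one_right (by positivity) ?_) (norm_nonneg _)
  exact Real.exp_le_one_iff.2 (div_nonpos_of_nonpos_of_nonneg (by simp [sq_nonneg])
    (by positivity))

theorem exp_mul_measureReal_closedBall_le [IsFiniteMeasure μ] {v : ℝ≥0} (r : ℝ) :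
    Real.exp (-(v * r ^ 2 / 2)) * μ.real (Metric.closedBall 0 r) ≤
      ‖∫ x, charFun μ x ∂gaussianReal 0 v‖ := by
  have hgauss : ∀ y : ℝ, charFun (gaussianReal 0 v) y = (Real.exp (-(v * y ^ 2 / 2)) : ℝ) :=
    fun y => by
      rw [charFun_gaussianReal]
      push_cast
      congr 1
      ring
  have hint : Integrable (fun y : ℝ => Real.exp (-(v * y ^ 2 / 2))) μ :=
    Integrable.of_bound (Continuous.aestronglyMeasurable (by fun_prop)) 1 (ae_of_all _ fun y => by
      rw [Real.norm_of_nonneg (Real.exp_pos _).le, Real.exp_le_one_iff, neg_nonpos]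
      positivity)
  rw [integral_charFun_comm]
  simp_rw [hgauss]
  rw [integral_complex_ofReal, Complex.norm_real]
  refine le_trans ?_ (le_abs_self _)
  rw [mul_comm, ← smul_eq_mul, ← setIntegral_const]
  refine (setIntegral_mono_on (integrableOn_const (by finiteness)) hint.integrableOn
    Metric.isClosed_closedBall.measurableSet fun y hy => ?_).trans
    (setIntegral_le_integral hint (ae_of_all _ fun _ => (Real.exp_pos _).le))
  have hyr : y ^ 2 ≤ r ^ 2 := sq_le_sq' (neg_le_of_abs_le (by simpa using hy))
    (le_of_abs_le (by simpa using hy))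
  gcongr

theorem measureReal_closedBall_zero_le_of_integrable_charFun [IsFiniteMeasure μ]
    (h : Integrable (charFun μ)) {r : ℝ} (hr : 0 < r) :
    μ.real (Metric.closedBall 0 r) ≤ Real.exp (1 / 2) * (∫ x, ‖charFun μ x‖) * r := by
  set v : ℝ≥0 := ⟨(r ^ 2)⁻¹, by positivity⟩
  have hvr : (v : ℝ) * r ^ 2 / 2 = 1 / 2 := by
    rw [show (v : ℝ) = (r ^ 2)⁻¹ from rfl, inv_mul_cancel₀ (by positivity)]
  have hv : (√(2 * Real.pi * v))⁻¹ ≤ r := by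
    rw [Real.sqrt_mul (by positivity), show √(v : ℝ) = r⁻¹ by
      rw [show (v : ℝ) = (r ^ 2)⁻¹ from rfl, Real.sqrt_inv, Real.sqrt_sq hr.le], mul_inv, inv_inv]
    refine mul_le_of_le_one_left hr.le (inv_le_one_of_one_le₀ (Real.one_le_sqrt.2 ?_))
    linarith [Real.pi_gt_three]
  have hv0 : v ≠ 0 := fun h0 => inv_ne_zero (pow_ne_zero 2 hr.ne') (congrArg NNReal.toReal h0)
  have hle := (exp_mul_measureReal_closedBall_le (μ := μ) (v := v) r).trans
    (norm_integral_charFun_gaussianReal_le h hv0)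
  rw [hvr, Real.exp_neg, inv_mul_le_iff₀ (Real.exp_pos _)] at hle
  calc μ.real (Metric.closedBall 0 r)
      ≤ Real.exp (1 / 2) * ((√(2 * Real.pi * v))⁻¹ * ∫ x, ‖charFun μ x‖) := hle
    _ ≤ Real.exp (1 / 2) * (r * ∫ x, ‖charFun μ x‖) := by gcongr
    _ = Real.exp (1 / 2) * (∫ x, ‖charFun μ x‖) * r := by ring

theorem measureReal_closedBall_le_of_integrable_charFun [IsFiniteMeasure μ]
    (h : Integrable (charFun μ)) (y : ℝ) {r : ℝ} (hr : 0 < r) :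
    μ.real (Metric.closedBall y r) ≤ Real.exp (1 / 2) * (∫ x, ‖charFun μ x‖) * r := by
  have hnorm : ∀ x, ‖charFun (μ.map (· + -y)) x‖ = ‖charFun μ x‖ := fun x => by
    rw [charFun_map_add_const, norm_mul, Complex.norm_exp_ofReal_mul_I, mul_one]
  have hi : Integrable (charFun (μ.map (· + -y))) :=
    h.norm.mono' (by fun_prop) (ae_of_all _ fun x => (hnorm x).le)
  have hball := measureReal_closedBall_zero_le_of_integrable_charFun hi hr
  simp_rw [hnorm] at hball
  rwa [map_measureReal_apply (measurable_add_const _) Metric.isClosed_closedBall.measurableSet,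
    Metric.preimage_add_right_closedBall, sub_neg_eq_add, zero_add] at hball

theorem absolutelyContinuous_of_integrable_charFun [IsFiniteMeasure μ]
    (h : Integrable (charFun μ)) : μ ≪ volume := by
  set C : ℝ := Real.exp (1 / 2) * ∫ x, ‖charFun μ x‖
  have hle : μ ≤ C.toNNReal • volume := by
    refine measure_le_of_forall_closedBall_le fun y r hr => ?_
    have hC : 0 ≤ C := by positivity
    rw [← ofReal_measureReal, Measure.smul_apply, Real.volume_closedBall, ENNReal.smul_def,
      smul_eq_mul, ← ENNReal.ofReal, ← ENNReal.ofReal_mul hC]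
    refine ENNReal.ofReal_le_ofReal
      ((measureReal_closedBall_le_of_integrable_charFun h y hr).trans ?_)
    gcongr
    linarith
  exact (Measure.absolutelyContinuous_of_le hle).trans Measure.smul_absolutelyContinuous

end AbsoluteContinuity

section Exponent

theorem tendsto_charFun_cocompact {E : Type*} [NormedAddCommGroup E] [InnerProductSpace ℝ E]
    [FiniteDimensional ℝ E] [MeasurableSpace E] [BorelSpace E] {μ : Measure E} [IsFiniteMeasure μ]
    (h : μ ≪ volume) : Tendsto (charFun μ) (cocompact E) (𝓝 0) := by
  have hπ : -(2 * Real.pi)⁻¹ ≠ 0 := neg_ne_zero.2 (by positivity)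
  have hRL := tendsto_integral_exp_inner_smul_cocompact fun v => ((μ.rnDeriv volume v).toReal : ℂ)
  refine (hRL.comp (Homeomorph.smulOfNeZero _ hπ).isClosedEmbedding.tendsto_cocompact).congr
    fun x => ?_
  rw [charFun_eq_fourierIntegral', VectorFourier.fourierIntegral, ← integral_rnDeriv_smul h]
  refine integral_congr_ae (ae_of_all _ fun v => ?_)
  simp [mul_comm, Circle.smul_def]

theorem one_sub_re_charFun_two_mul_le {μ : Measure ℝ} [IsProbabilityMeasure μ] (x : ℝ) :
    1 - (charFun μ (2 * x)).re ≤ 4 * (1 - (charFun μ x).re) := by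
  have hcos : ∀ u : ℝ, Integrable (fun y => Real.cos (u * y)) μ := fun u =>
    Integrable.of_bound (Continuous.aestronglyMeasurable (by fun_prop)) 1 (ae_of_all _ fun y =>
      Real.abs_cos_le_one _)
  have hint : ∀ u : ℝ, Integrable (fun y => 1 - Real.cos (u * y)) μ := fun u =>
    (integrable_const 1).sub (hcos u)
  have hre : ∀ u, 1 - (charFun μ u).re = ∫ y, (1 - Real.cos (u * y)) ∂μ := fun u => by
    have hexp : Integrable (fun y : ℝ => Complex.exp (u * y * Complex.I)) μ :=
      Integrable.of_bound (Continuous.aestronglyMeasurable (by fun_prop)) 1 (ae_of_all _ fun y => by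
        rw [← Complex.ofReal_mul, Complex.norm_exp_ofReal_mul_I])
    rw [integral_sub (integrable_const _) (hcos u), charFun_apply_real, ← RCLike.re_eq_complex_re,
      ← integral_re hexp]
    simp [← Complex.ofReal_mul, Complex.exp_ofReal_mul_I_re]
  rw [hre, hre, ← integral_const_mul]
  refine integral_mono (hint _) ((hint x).const_mul 4) fun y => ?_
  dsimp only
  rw [mul_assoc, Real.cos_two_mul]
  nlinarith [sq_nonneg (1 - Real.cos (x * y))]

namespace IsRegularLevy

variable {Ω : Type*} [MeasurableSpace Ω] {P : Measure Ω} {Z : ℝ → Ω → ℝ} {Ψ : ℝ → ℝ}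
  {ℓ : ℝ}

theorem exponent_abs (h : IsRegularLevy Z P Ψ) (u : ℝ) : Ψ |u| = Ψ u := by
  rcases abs_choice u with hu | hu <;> rw [hu]
  exact h.exponent_neg u

theorem tendsto_exponent_div_sq (h : IsRegularLevy Z P Ψ)
    (hlim : Tendsto (fun x => Ψ x / x ^ 2) (𝓝[>] 0) (𝓝 ℓ)) :
    Tendsto (fun x => Ψ x / x ^ 2) (𝓝[≠] 0) (𝓝 ℓ) :=
  (hlim.comp tendsto_abs_nhdsNE_zero).congr fun x => by
    rw [Function.comp_apply, h.exponent_abs, sq_abs]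

variable [IsProbabilityMeasure P]

theorem exponent_zero (h : IsRegularLevy Z P Ψ) : Ψ 0 = 0 := by
  have hexp := h.exp_neg_exponent 0
  have : IsProbabilityMeasure (P.map (Z 1)) :=
    Measure.isProbabilityMeasure_map (h.measurable 1).aemeasurable
  simpa using hexp

theorem integrable_exp_neg_mul_exponent (h : IsRegularLevy Z P Ψ)
    (hint : Integrable fun x => 1 / (1 + Ψ x)) {s : ℝ} (hs : 0 < s) :
    Integrable fun x => Real.exp (-(s * Ψ x)) := by
  have hΨ := h.continuous_exponent.measurable
  refine (hint.const_mul (max 1 s⁻¹)).mono' (by fun_prop) (ae_of_all _ fun x => ?_)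
  have hΨx := h.exponent_nonneg x
  have hsΨ : 1 + Ψ x ≤ max 1 s⁻¹ * (1 + s * Ψ x) := by
    calc 1 + Ψ x = 1 * 1 + s⁻¹ * (s * Ψ x) := by rw [one_mul, inv_mul_cancel_left₀ hs.ne']
      _ ≤ max 1 s⁻¹ * 1 + max 1 s⁻¹ * (s * Ψ x) := by
        gcongr
        exacts [le_max_left _ _, le_max_right _ _]
      _ = max 1 s⁻¹ * (1 + s * Ψ x) := by ring
  rw [Real.norm_of_nonneg (Real.exp_pos _).le, Real.exp_neg, mul_one_div,
    le_div_iff₀ (by positivity), inv_mul_le_iff₀ (Real.exp_pos _), mul_comm]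
  refine hsΨ.trans (mul_le_mul_of_nonneg_left ?_ (by positivity))
  rw [add_comm]
  exact Real.add_one_le_exp _

theorem absolutelyContinuous_map (h : IsRegularLevy Z P Ψ)
    (hint : Integrable fun x => 1 / (1 + Ψ x)) {s : ℝ} (hs : 0 < s) :
    P.map (Z s) ≪ volume := by
  have : IsProbabilityMeasure (P.map (Z s)) :=
    Measure.isProbabilityMeasure_map (h.measurable s).aemeasurable
  refine absolutelyContinuous_of_integrable_charFun ?_
  rw [funext (h.charFun_map hs.le)]
  exact (h.integrable_exp_neg_mul_exponent hint hs).ofReal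

theorem ae_comp_ae_eq (h : IsRegularLevy Z P Ψ) (hint : Integrable fun x => 1 / (1 + Ψ x))
    {β : Type*} {f g : ℝ → β} (hfg : f =ᵐ[volume] g) (T : ℝ) :
    ∀ᵐ ω ∂P, (fun s => f (Z s ω)) =ᵐ[volume.restrict (Set.Ioc 0 T)] fun s => g (Z s ω) := by
  set N := toMeasurable volume {y | f y ≠ g y}
  have hN : MeasurableSet N := measurableSet_toMeasurable _ _
  have hN0 : volume N = 0 := (measure_toMeasurable _).trans hfg
  have havoid : ∀ᵐ s ∂volume.restrict (Set.Ioc 0 T), ∀ᵐ ω ∂P, Z s ω ∉ N := by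
    filter_upwards [ae_restrict_mem measurableSet_Ioc] with s hs
    have hNs := h.absolutelyContinuous_map hint hs.1 hN0
    rw [Measure.map_apply (h.measurable s) hN] at hNs
    exact measure_eq_zero_iff_ae_notMem.1 hNs
  rw [Measure.ae_ae_comm (p := fun s ω => Z s ω ∉ N) (h.measurable_uncurry hN.compl)] at havoid
  filter_upwards [havoid] with ω hω
  filter_upwards [hω] with s hs
  exact not_not.1 fun hne => hs (subset_toMeasurable _ _ hne)

theorem tendsto_exponent_cocompact (h : IsRegularLevy Z P Ψ)
    (hint : Integrable fun x => 1 / (1 + Ψ x)) : Tendsto Ψ (cocompact ℝ) atTop := by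
  have hφ : Tendsto (fun u => Real.exp (-Ψ u)) (cocompact ℝ) (𝓝 0) := by
    have : IsProbabilityMeasure (P.map (Z 1)) :=
      Measure.isProbabilityMeasure_map (h.measurable 1).aemeasurable
    rw [funext h.exp_neg_exponent]
    exact (Complex.continuous_re.tendsto' 0 0 Complex.zero_re).comp
      (tendsto_charFun_cocompact (h.absolutelyContinuous_map hint one_pos))
  exact tendsto_neg_atBot_iff.1 (Real.tendsto_exp_comp_nhds_zero.1 hφ)

theorem exponent_two_mul_eq_zero (h : IsRegularLevy Z P Ψ) {x : ℝ} (hx : Ψ x = 0) :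
    Ψ (2 * x) = 0 := by
  have : IsProbabilityMeasure (P.map (Z 1)) :=
    Measure.isProbabilityMeasure_map (h.measurable 1).aemeasurable
  have hdouble := one_sub_re_charFun_two_mul_le (μ := P.map (Z 1)) x
  rw [← h.exp_neg_exponent, ← h.exp_neg_exponent, hx, neg_zero, Real.exp_zero, sub_self, mul_zero,
    sub_nonpos, Real.one_le_exp_iff, Left.nonneg_neg_iff] at hdouble
  exact le_antisymm hdouble (h.exponent_nonneg _)

theorem exponent_pos (h : IsRegularLevy Z P Ψ) (hint : Integrable fun x => 1 / (1 + Ψ x)) {x : ℝ}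
    (hx : x ≠ 0) : 0 < Ψ x := by
  refine (h.exponent_nonneg x).lt_of_ne' fun hx0 => ?_
  have hzero : ∀ n : ℕ, Ψ (2 ^ n * x) = 0 := by
    intro n
    induction n with
    | zero => simpa using hx0
    | succ n ih => rw [pow_succ', mul_assoc, h.exponent_two_mul_eq_zero ih]
  have hfar : Tendsto (fun n : ℕ => (2 : ℝ) ^ n * x) atTop (cocompact ℝ) :=
    (tendsto_cocompact_mul_right₀ hx).comp
      ((tendsto_pow_atTop_atTop_of_one_lt one_lt_two).mono_right atTop_le_cocompact)
  have hlim := (h.tendsto_exponent_cocompact hint).comp hfar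
  simp only [Function.comp_def, hzero] at hlim
  exact not_tendsto_const_atTop _ _ hlim

theorem exists_pos_forall_le_exponent (h : IsRegularLevy Z P Ψ)
    (hint : Integrable fun x => 1 / (1 + Ψ x)) {δ : ℝ} (hδ : 0 < δ) :
    ∃ c, 0 < c ∧ ∀ x, δ ≤ |x| → c ≤ Ψ x := by
  have hclosed : IsClosed {x : ℝ | δ ≤ |x|} := isClosed_le continuous_const continuous_abs
  obtain ⟨x, hx, hmin⟩ := h.continuous_exponent.continuousOn.exists_isMinOn' hclosed
    (x₀ := δ) (le_abs_self δ)
    (((h.tendsto_exponent_cocompact hint).eventually_ge_atTop _).filter_mono inf_le_left)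
  exact ⟨Ψ x, h.exponent_pos hint (abs_pos.1 (hδ.trans_le hx)), fun y hy => hmin hy⟩

theorem ellLower_pos (h : IsRegularLevy Z P Ψ) (hint : Integrable fun x => 1 / (1 + Ψ x))
    (hℓ : 0 < ℓ) (hlim : Tendsto (fun x => Ψ x / x ^ 2) (𝓝[>] 0) (𝓝 ℓ)) {δ : ℝ} (hδ : 0 < δ) :
    0 < ellLower Ψ δ := by
  have hnear := (h.tendsto_exponent_div_sq hlim).eventually (le_mem_nhds (half_lt_self hℓ))
  obtain ⟨η, hη, hball⟩ := Metric.eventually_nhds_iff.1 (eventually_nhdsWithin_iff.1 hnear)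
  obtain ⟨c, hc, hfar⟩ := h.exists_pos_forall_le_exponent hint hη
  have hmin : 0 < min (ℓ / 2) (c / δ ^ 2) := by positivity
  refine hmin.trans_le (le_csInf ⟨_, δ, ⟨hδ.ne', (abs_of_pos hδ).le⟩, rfl⟩ ?_)
  rintro _ ⟨x, ⟨hx, hxδ⟩, rfl⟩
  rcases lt_or_ge |x| η with hxη | hηx
  · exact (min_le_left _ _).trans (hball (by rwa [Real.dist_0_eq_abs]) hx)
  · refine (min_le_right _ _).trans (div_le_div₀ (h.exponent_nonneg x) (hfar x hηx)
      (by positivity) ?_)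
    exact sq_le_sq' (neg_le_of_abs_le hxδ) (le_of_abs_le hxδ)

theorem tendsto_sq_mul_exponent_div (h : IsRegularLevy Z P Ψ)
    (hlim : Tendsto (fun x => Ψ x / x ^ 2) (𝓝[>] 0) (𝓝 ℓ)) {ι : Type*} {l : Filter ι} {a : ι → ℝ}
    (ha_pos : ∀ i, 0 < a i) (ha : Tendsto a l atTop) (v : ℝ) :
    Tendsto (fun i => a i ^ 2 * Ψ (v / a i)) l (𝓝 (ℓ * v ^ 2)) := by
  rcases eq_or_ne v 0 with rfl | hv
  · simp [h.exponent_zero, tendsto_const_nhds]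
  · have hva : Tendsto (fun i => v / a i) l (𝓝[≠] 0) :=
      tendsto_nhdsWithin_iff.2 ⟨ha.const_div_atTop v,
        .of_forall fun i => div_ne_zero hv (ha_pos i).ne'⟩
    refine (((h.tendsto_exponent_div_sq hlim).comp hva).mul_const (v ^ 2)).congr fun i => ?_
    have := (ha_pos i).ne'
    simp only [Function.comp_apply]
    field_simp

end IsRegularLevy

theorem ellLower_mul_sq_le {Ψ : ℝ → ℝ} (hΨ : ∀ x, 0 ≤ Ψ x) {δ v : ℝ} (hv : |v| ≤ δ) :
    ellLower Ψ δ * v ^ 2 ≤ Ψ v := by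
  rcases eq_or_ne v 0 with rfl | hv0
  · simpa using hΨ 0
  · rw [← le_div_iff₀ (by positivity)]
    refine csInf_le ⟨0, ?_⟩ ⟨v, ⟨hv0, hv⟩, rfl⟩
    rintro _ ⟨x, -, rfl⟩
    exact div_nonneg (hΨ x) (sq_nonneg x)

end Exponent

section UniformIntegrability

theorem uniformIntegrable_of_eLpNorm_le {α β ι : Type*} [MeasurableSpace α] [NormedAddCommGroup β]
    {μ : Measure α} [IsFiniteMeasure μ] {f : ι → α → β} {p q : ℝ≥0∞} (hp : p ≠ 0) (hpq : p < q)
    (hf : ∀ i, AEStronglyMeasurable (f i) μ) {C : ℝ≥0} (hC : ∀ i, eLpNorm (f i) q μ ≤ C) :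
    UniformIntegrable f p μ := by
  set r := 1 / p.toReal - 1 / q.toReal
  have hr : 0 < r := by
    rcases eq_or_ne q ∞ with rfl | hq
    · simpa [r] using ENNReal.toReal_pos hp hpq.ne
    · exact sub_pos.2 (one_div_lt_one_div_of_lt (ENNReal.toReal_pos hp (hpq.trans_le le_top).ne)
        ((ENNReal.toReal_lt_toReal (hpq.trans_le le_top).ne hq).2 hpq))
  have hHolder : ∀ i s, MeasurableSet s →
      eLpNorm (s.indicator (f i)) p μ ≤ C * μ s ^ r := fun i s hs => by
    rw [eLpNorm_indicator_eq_eLpNorm_restrict hs]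
    refine (eLpNorm_le_eLpNorm_mul_rpow_measure_univ hpq.le (hf i).restrict).trans ?_
    rw [Measure.restrict_apply_univ]
    gcongr
    exact (eLpNorm_mono_measure _ Measure.restrict_le_self).trans (hC i)
  refine ⟨hf, fun ε hε => ?_, (C * μ Set.univ ^ r).toNNReal, fun i => ?_⟩
  · have hlim : Tendsto (fun δ : ℝ => C * ENNReal.ofReal δ ^ r) (𝓝[>] 0) (𝓝 0) := by
      refine (Continuous.tendsto' (f := fun δ : ℝ => C * ENNReal.ofReal δ ^ r) ?_ 0 0
        (by simp [hr])).mono_left nhdsWithin_le_nhds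
      exact (ENNReal.continuous_const_mul ENNReal.coe_ne_top).comp
        (ENNReal.continuous_rpow_const.comp ENNReal.continuous_ofReal)
    obtain ⟨δ, hδε, hδ⟩ := ((hlim.eventually_le_const (ENNReal.ofReal_pos.2 hε)).and
      self_mem_nhdsWithin).exists
    refine ⟨δ, hδ, fun i s hs hsδ => (hHolder i s hs).trans (le_trans ?_ hδε)⟩
    gcongr
  · rw [ENNReal.coe_toNNReal (by finiteness)]
    simpa using hHolder i _ MeasurableSet.univ

theorem uniformIntegrable_of_integral_sq_le {Ω ι : Type*} [MeasurableSpace Ω] {P : Measure Ω}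
    [IsFiniteMeasure P] {Y : ι → Ω → ℝ} (hY : ∀ i, MemLp (Y i) 2 P) {C : ℝ}
    (hC : ∀ i, ∫ ω, Y i ω ^ 2 ∂P ≤ C) : UniformIntegrable Y 1 P := by
  refine uniformIntegrable_of_eLpNorm_le (q := 2) one_ne_zero (by norm_num) (fun i => (hY i).1)
    (C := (C ^ (2 : ℝ)⁻¹).toNNReal) fun i => ?_
  rw [(hY i).eLpNorm_eq_integral_rpow_norm two_ne_zero ENNReal.ofNat_ne_top]
  refine ENNReal.ofReal_le_ofReal (Real.rpow_le_rpow (by positivity) ?_ (by positivity))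
  simpa using hC i

end UniformIntegrability

section IndependentIncrements

variable {Ω E T : Type*} [MeasurableSpace Ω] {P : Measure Ω} [MeasurableSpace E]

theorem indepFun_partialSums [AddCommMonoid E] [MeasurableAdd₂ E] {Y : ℕ → Ω → E}
    (hY : iIndepFun Y P) (hm : ∀ i, Measurable (Y i)) (m : ℕ) :
    IndepFun (fun ω (i : Set.Iic m) => ∑ j ∈ Finset.range i, Y j ω) (Y m) P := by
  have hpast := hY.indepFun_finset (Finset.range m) {m} (by simp) hm
  have hφ : Measurable fun (y : Finset.range m → E) (i : Set.Iic m) =>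
      ∑ j : Fin i, y ⟨j, Finset.mem_range.2 (j.2.trans_le i.2)⟩ :=
    measurable_pi_lambda _ fun i => Finset.measurable_sum _ fun j _ => measurable_pi_apply _
  have hψ : Measurable fun y : ({m} : Finset ℕ) → E => y ⟨m, Finset.mem_singleton_self m⟩ :=
    measurable_pi_apply _
  simp only [Finset.sum_range]
  exact hpast.comp hφ hψ

theorem exists_monotone_nat_of_forall_le [LinearOrder T] (J : Finset T) {s τ : T}
    (hJ : ∀ r ∈ J, r ≤ s) (hsτ : s ≤ τ) :
    ∃ (θ : ℕ → T) (m : ℕ), Monotone θ ∧ θ m = s ∧ θ (m + 1) = τ ∧ ∀ r ∈ J, ∃ i ≤ m, θ i = r := by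
  induction J using Finset.induction_on_max generalizing s τ with
  | empty =>
    refine ⟨fun i => if i = 0 then s else τ, 0, monotone_nat_of_le_succ fun i => ?_, by simp⟩
    rcases i.eq_zero_or_pos with rfl | hi
    · simpa using hsτ
    · simp [hi.ne']
  | insert a J hJa ih =>
    obtain ⟨θ, m, hθ, hθm, hθs, hθJ⟩ :=
      ih (fun r hr => (hJa r hr).le) (hJ a (Finset.mem_insert_self _ _))
    refine ⟨fun i => if i ≤ m + 1 then θ i else τ, m + 1, monotone_nat_of_le_succ fun i => ?_,
      by simpa using hθs, by simp, fun r hr => ?_⟩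
    · split_ifs with hi hi' hi'
      · exact hθ i.le_succ
      · exact (hθ hi).trans (hθs.trans_le hsτ)
      · omega
      · exact le_rfl
    · rcases Finset.mem_insert.1 hr with rfl | hr
      · exact ⟨m, m.le_succ, by simpa using hθm⟩
      · obtain ⟨i, him, hir⟩ := hθJ r hr
        exact ⟨i, him.trans m.le_succ, by simpa [him.trans m.le_succ] using hir⟩

theorem indepFun_past_increment [LinearOrder T] [OrderBot T] [AddCommGroup E] [MeasurableAdd₂ E]
    [MeasurableSub₂ E] [IsZeroOrProbabilityMeasure P] {X : T → Ω → E} (hX : HasIndepIncrements X P)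
    (hm : ∀ t, Measurable (X t)) (h0 : ∀ᵐ ω ∂P, X ⊥ ω = 0) {s τ : T} (hsτ : s ≤ τ) :
    IndepFun (fun ω (r : Set.Iic s) => X r ω) (fun ω => X τ ω - X s ω) P := by
  refine IndepFun.process_indepFun (fun r => hm r) ((hm τ).sub (hm s)) fun I => ?_
  obtain ⟨θ, m, hθ, rfl, rfl, hθJ⟩ := exists_monotone_nat_of_forall_le
    (insert ⊥ (I.map ⟨_, Subtype.val_injective⟩)) (s := s) (by
      simp only [Finset.mem_insert, Finset.mem_map, Function.Embedding.coeFn_mk]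
      rintro _ (rfl | ⟨r, -, rfl⟩)
      exacts [bot_le, r.2]) hsτ
  obtain ⟨i₀, -, hi₀⟩ := hθJ ⊥ (Finset.mem_insert_self _ _)
  have hθ0 : θ 0 = ⊥ := le_bot_iff.1 ((hθ i₀.zero_le).trans_eq hi₀)
  have hidx : ∀ r : I, ∃ i ≤ m, θ i = r := fun r =>
    hθJ r (Finset.mem_insert_of_mem (Finset.mem_map_of_mem _ r.2))
  choose idx hidxm hidxθ using hidx
  have hpast := (indepFun_partialSums (hX.nat hθ) (fun i => (hm _).sub (hm _)) m).comp
    (φ := fun (y : Set.Iic m → E) (r : I) => y ⟨idx r, hidxm r⟩) (by fun_prop) measurable_id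
  refine hpast.congr ?_ .rfl
  filter_upwards [h0] with ω hω
  funext r
  simp only [Function.comp_apply]
  rw [Finset.sum_range_sub fun i => X (θ i) ω, hidxθ, hθ0, hω, sub_zero]

end IndependentIncrements

section Regularization

variable {Ω : Type*} [MeasurableSpace Ω] {P : Measure Ω} {X : ℝ≥0 → Ω → ℝ} {Ψ : ℝ → ℝ}

theorem HasCharExponent.integral_exp (h : HasCharExponent X P Ψ) (s : ℝ≥0) (u : ℝ) :
    ∫ ω, Complex.exp (Complex.I * (u * X s ω : ℝ)) ∂P = (Real.exp (-(s * Ψ u)) : ℂ) := by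
  have hconj := congrArg (starRingEnd ℂ) (h s u)
  rw [← integral_conj] at hconj
  simpa [← Complex.exp_conj, mul_assoc] using hconj

namespace IsLevyProcess

theorem integral_exp_sub (hX : IsLevyProcess X P) (hXΨ : HasCharExponent X P Ψ) {s τ : ℝ≥0}
    (hsτ : s ≤ τ) (u : ℝ) :
    ∫ ω, Complex.exp (Complex.I * (u * (X τ ω - X s ω) : ℝ)) ∂P =
      (Real.exp (-((τ - s) * Ψ u)) : ℂ) := by
  have hst := hX.stationary_increments s (τ - s)
  rw [add_tsub_cancel_of_le hsτ] at hst
  have hexp : Measurable fun x : ℝ => Complex.exp (Complex.I * (u * x : ℝ)) := by fun_prop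
  rw [← NNReal.coe_sub hsτ, ← hXΨ.integral_exp]
  exact (hst.comp hexp).integral_eq

theorem exists_rightContinuous_modification (hX : IsLevyProcess X P) :
    ∃ Y : ℝ≥0 → Ω → ℝ, (∀ s, Measurable (Y s)) ∧
      (∀ ω s, ContinuousWithinAt (fun r => Y r ω) (Set.Ici s) s) ∧
      ∀ᵐ ω ∂P, ∀ s, Y s ω = X s ω := by
  obtain ⟨N, hNsub, hNm, hN0⟩ := exists_measurable_superset_of_null (ae_iff.1 hX.cadlag)
  refine ⟨fun s => Nᶜ.indicator (X s), fun s => (hX.measurable s).indicator hNm.compl,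
    fun ω s => ?_, ?_⟩
  · by_cases hω : ω ∈ N
    · simpa [hω] using continuousWithinAt_const
    · simpa [hω] using (not_not.1 (mt (@hNsub ω) hω) s).1
  · filter_upwards [measure_eq_zero_iff_ae_notMem.1 hN0] with ω hω s
    simp [hω]

theorem exists_isRegularLevy [IsProbabilityMeasure P] (hX : IsLevyProcess X P)
    (hXΨ : HasCharExponent X P Ψ) :
    ∃ Z : ℝ → Ω → ℝ, IsRegularLevy Z P Ψ ∧ ∀ᵐ ω ∂P, ∀ s : ℝ, Z s ω = X s.toNNReal ω := by
  obtain ⟨Y, hYm, hYcont, hYX⟩ := hX.exists_rightContinuous_modification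
  have hYX' : ∀ s, X s =ᵐ[P] Y s := fun s => by
    filter_upwards [hYX] with ω hω using (hω s).symm
  refine ⟨fun s => Y s.toNNReal, ⟨fun s => hYm _, fun ω s => ?_, ?_, fun s τ _ hsτ => ?_,
    fun s τ u hs hsτ => ?_⟩, by filter_upwards [hYX] with ω hω s using hω _⟩
  · exact (hYcont ω s.toNNReal).comp continuous_real_toNNReal.continuousWithinAt
      fun r hr => Real.toNNReal_le_toNNReal hr.le
  · filter_upwards [hYX, hX.start_zero] with ω hω h0
    simpa [hω] using h0
  · have hpast := (indepFun_past_increment hX.indep_increments hX.measurable hX.start_zero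
      (Real.toNNReal_le_toNNReal hsτ)).comp
        (φ := fun (x : Set.Iic s.toNNReal → ℝ) (r : Set.Iic s) =>
          x ⟨(r : ℝ).toNNReal, Real.toNNReal_le_toNNReal r.2⟩) (by fun_prop) measurable_id
    exact (IndepFun.process_congr_left hpast fun r => hYX' _).congr .rfl
      ((hYX' _).sub (hYX' _))
  · have hexp := hX.integral_exp_sub hXΨ (Real.toNNReal_le_toNNReal hsτ) u
    rw [Real.coe_toNNReal s hs, Real.coe_toNNReal τ (hs.trans hsτ)] at hexp
    rw [← hexp]
    refine integral_congr_ae ?_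
    filter_upwards [hYX] with ω hω
    rw [hω, hω]

end IsLevyProcess

end Regularization

section Residual

variable {f : ℝ → ℂ} {δ : ℝ}

/-- The spectral density of `f` after removal of the constant `angularFourier f 0` on the frequency
window `(-δ, δ]`; it vanishes at the zero frequency. -/
noncomputable def residualSpectrum (f : ℝ → ℂ) (δ x : ℝ) : ℂ :=
  ((2 * Real.pi : ℝ) : ℂ)⁻¹ *
    (angularFourier f x - (Set.Ioc (-δ) δ).indicator (fun _ => angularFourier f 0) x)

theorem norm_residualSpectrum (f : ℝ → ℂ) (δ x : ℝ) : ‖residualSpectrum f δ x‖ =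
    (2 * Real.pi)⁻¹ *
      ‖angularFourier f x - (Set.Ioc (-δ) δ).indicator (fun _ => angularFourier f 0) x‖ := by
  rw [residualSpectrum, norm_mul, norm_inv, Complex.norm_real, Real.norm_of_nonneg (by positivity)]

theorem measurable_residualSpectrum (hf : AEStronglyMeasurable f) (δ : ℝ) :
    Measurable (residualSpectrum f δ) :=
  ((measurable_angularFourier hf).sub (measurable_const.indicator measurableSet_Ioc)).const_mul _

theorem integrable_indicator_Ioc_const (c : ℂ) (a b : ℝ) :
    Integrable ((Set.Ioc a b).indicator fun _ => c) :=
  (integrable_indicator_iff measurableSet_Ioc).2 (integrableOn_const (by simp))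

theorem integrable_residualSpectrum (hf : Integrable (angularFourier f)) (δ : ℝ) :
    Integrable (residualSpectrum f δ) :=
  (hf.sub (integrable_indicator_Ioc_const _ _ _)).const_mul _

theorem norm_residualSpectrum_le (f : ℝ → ℂ) (δ x : ℝ) :
    ‖residualSpectrum f δ x‖ ≤ (2 * Real.pi)⁻¹ * ((∫ y, ‖f y‖) + ∫ y, ‖f y‖) := by
  rw [norm_residualSpectrum]
  gcongr
  refine (norm_sub_le _ _).trans (add_le_add (norm_angularFourier_le f x) ?_)
  exact (norm_indicator_le_norm_self _ _).trans (norm_angularFourier_le f 0)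

theorem phaseIntegral_indicator_Ioc (c : ℂ) (hδ : 0 ≤ δ) (y : ℝ) :
    phaseIntegral (fun x => ((2 * Real.pi : ℝ) : ℂ)⁻¹ * (Set.Ioc (-δ) δ).indicator (fun _ => c) x)
      y = c * sincKernel δ y := by
  rw [ofReal_sincKernel, intervalIntegral.integral_of_le (by linarith),
    ← integral_indicator measurableSet_Ioc, phaseIntegral, mul_left_comm, ← integral_const_mul,
    ← integral_const_mul]
  refine integral_congr_ae (ae_of_all _ fun x => ?_)
  by_cases hx : x ∈ Set.Ioc (-δ) δ <;> simp [hx, mul_assoc]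

theorem phaseIntegral_residualSpectrum (hf : Integrable (angularFourier f)) (hδ : 0 ≤ δ) (y : ℝ) :
    phaseIntegral (residualSpectrum f δ) y =
      phaseIntegral (fun x => ((2 * Real.pi : ℝ) : ℂ)⁻¹ * angularFourier f x) y -
        angularFourier f 0 * sincKernel δ y := by
  rw [← phaseIntegral_indicator_Ioc _ hδ, phaseIntegral, phaseIntegral, phaseIntegral,
    ← integral_sub]
  · simp only [residualSpectrum, mul_sub, sub_mul]
  · exact integrable_mul_exp_I_mul_ofReal (hf.const_mul _) y
  · exact integrable_mul_exp_I_mul_ofReal ((integrable_indicator_Ioc_const _ _ _).const_mul _) y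

theorem lintegral_residualSpectrum_ne_top {Ψ : ℝ → ℝ} (hf : Integrable (angularFourier f))
    (hf₀ : Integrable fun x => ‖angularFourier f x - angularFourier f 0‖ / x ^ 2) {b c : ℝ}
    (hb : 0 < b) (hnear : ∀ x, |x| ≤ δ → b * x ^ 2 ≤ Ψ x)
    (hc : 0 < c) (hfar : ∀ x, δ ≤ |x| → c ≤ Ψ x) :
    ∫⁻ x, ‖residualSpectrum f δ x‖ₑ * (ENNReal.ofReal (Ψ x))⁻¹ ≠ ∞ := by
  have hdom : Integrable fun x => (2 * Real.pi)⁻¹ *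
      (b⁻¹ * (‖angularFourier f x - angularFourier f 0‖ / x ^ 2) + c⁻¹ * ‖angularFourier f x‖) :=
    ((hf₀.const_mul _).add (hf.norm.const_mul _)).const_mul _
  refine ((lintegral_mono_ae ?_).trans_lt hdom.lintegral_lt_top).ne
  filter_upwards [Measure.ae_ne volume 0] with x hx
  have hinside : |x| ≤ δ → (ENNReal.ofReal (Ψ x))⁻¹ ≤ ENNReal.ofReal (b * x ^ 2)⁻¹ := fun hxδ => by
    rw [ENNReal.ofReal_inv_of_pos (by positivity)]
    gcongr
    exact hnear x hxδ
  have houtside : δ ≤ |x| → (ENNReal.ofReal (Ψ x))⁻¹ ≤ ENNReal.ofReal c⁻¹ := fun hxδ => by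
    rw [ENNReal.ofReal_inv_of_pos hc]
    gcongr
    exact hfar x hxδ
  rw [← ofReal_norm, norm_residualSpectrum]
  by_cases hxδ : x ∈ Set.Ioc (-δ) δ
  · rw [Set.indicator_of_mem hxδ]
    refine (mul_le_mul_right (hinside (abs_le.2 ⟨hxδ.1.le, hxδ.2⟩)) _).trans ?_
    rw [← ENNReal.ofReal_mul (by positivity)]
    refine ENNReal.ofReal_le_ofReal ?_
    calc (2 * Real.pi)⁻¹ * ‖angularFourier f x - angularFourier f 0‖ * (b * x ^ 2)⁻¹
        = (2 * Real.pi)⁻¹ * (b⁻¹ * (‖angularFourier f x - angularFourier f 0‖ / x ^ 2)) := by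
          rw [mul_inv, div_eq_mul_inv]
          ring
      _ ≤ _ := by
          gcongr
          exact le_add_of_nonneg_right (by positivity)
  · rw [Set.indicator_of_notMem hxδ, sub_zero]
    have hδx : δ ≤ |x| := by
      by_contra! hlt
      exact hxδ ⟨(abs_lt.1 hlt).1, (abs_lt.1 hlt).2.le⟩
    refine (mul_le_mul_right (houtside hδx) _).trans ?_
    rw [← ENNReal.ofReal_mul (by positivity)]
    refine ENNReal.ofReal_le_ofReal ?_
    rw [mul_assoc, mul_comm _ c⁻¹]
    gcongr
    exact le_add_of_nonneg_left (by positivity)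

end Residual

section Window

theorem ellLower_mul_sq_le_rescale {Ψ : ℝ → ℝ} (hΨ : ∀ x, 0 ≤ Ψ x) {b R v : ℝ} (hb : 0 < b)
    (hv : |v| ≤ R * b) : ellLower Ψ R * v ^ 2 ≤ b ^ 2 * Ψ (v / b) := by
  have hvb : |v / b| ≤ R := by rwa [abs_div, abs_of_pos hb, div_le_iff₀ hb]
  calc ellLower Ψ R * v ^ 2 = b ^ 2 * (ellLower Ψ R * (v / b) ^ 2) := by field_simp
    _ ≤ b ^ 2 * Ψ (v / b) := by gcongr; exact ellLower_mul_sq_le hΨ hvb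

theorem chainKernel_gaussian_zero_ne_top {b τ : ℝ} (hb : 0 < b) (hτ : 0 < τ) (k : ℕ) :
    chainKernel (fun v => b * v ^ 2) Set.univ k τ 0 ≠ ∞ := by
  rw [chainKernel_gaussian_zero hb k hτ]
  exact ENNReal.ofReal_ne_top

theorem factorial_mul_toReal_chainKernel_gaussian {b t : ℝ} (hb : 0 < b) (ht : 0 < t) (k : ℕ) :
    k.factorial * (chainKernel (fun v => b * v ^ 2) Set.univ k (t ^ 2) 0).toReal =
      (t / (2 * √b)) ^ k * (k.factorial / Real.Gamma (1 + (k : ℝ) / 2)) := by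
  have : 0 < Real.Gamma (1 + (k : ℝ) / 2) := Real.Gamma_pos_of_pos (by positivity)
  have hpow : (t ^ 2) ^ ((k : ℝ) / 2) = t ^ k := by
    rw [← Real.rpow_natCast_mul ht.le, Nat.cast_ofNat, mul_div_cancel₀ _ two_ne_zero,
      Real.rpow_natCast]
  rw [chainKernel_gaussian_zero hb k (by positivity), hpow, ENNReal.toReal_ofReal (by positivity),
    ← mul_pow, one_div_mul_eq_div]
  ring

theorem div_two_mul_sqrt_pow_two_mul {b : ℝ} (hb : 0 ≤ b) (t : ℝ) (k : ℕ) :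
    (t / (2 * √b)) ^ (2 * k) = (t ^ 2 / (4 * b)) ^ k := by
  rw [pow_mul, div_pow, mul_pow, Real.sq_sqrt hb]
  norm_num

/-- The contribution of the frequency window `(-δ, δ]`, normalized to unit mass at frequency zero,
to the additive functional `b⁻¹ ∫₀^{t² b²} f(Z_s) ds`. -/
noncomputable def windowFunctional {Ω : Type*} (Z : ℝ → Ω → ℝ) (δ b t : ℝ) (ω : Ω) : ℝ :=
  b⁻¹ * occupation Z (sincKernel δ) (t ^ 2 * b ^ 2) ω

theorem windowFunctional_eq_occupation {Ω : Type*} (Z : ℝ → Ω → ℝ) {b : ℝ} (hb : b ≠ 0)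
    (δ t : ℝ) (ω : Ω) : windowFunctional Z δ b t ω =
      occupation (fun r ω => Z (b ^ 2 * r) ω / b) (sincKernel (b * δ)) (t ^ 2) ω := by
  rw [occupation_rescale Z hb, mul_comm (b ^ 2), windowFunctional]

namespace IsRegularLevy

variable {Ω : Type*} [MeasurableSpace Ω] {P : Measure Ω} {Z : ℝ → Ω → ℝ} {Ψ : ℝ → ℝ}

theorem memLp_windowFunctional_pow [IsFiniteMeasure P] (h : IsRegularLevy Z P Ψ) (δ b t : ℝ)
    (k : ℕ) (p : ℝ≥0∞) : MemLp (fun ω => windowFunctional Z δ b t ω ^ k) p P := by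
  have hT : 0 ≤ t ^ 2 * b ^ 2 := by positivity
  refine MemLp.of_bound (((h.measurable_occupation (continuous_sincKernel δ).measurable
      _).const_mul b⁻¹).pow_const k).aestronglyMeasurable
    ((|b⁻¹| * ((2 * Real.pi)⁻¹ * |δ - -δ| * (t ^ 2 * b ^ 2))) ^ k) (ae_of_all _ fun ω => ?_)
  rw [norm_pow, Real.norm_eq_abs, windowFunctional, abs_mul]
  gcongr
  exact abs_occupation_le (abs_sincKernel_le δ) hT ω

variable [IsProbabilityMeasure P]

theorem integral_windowFunctional_pow (h : IsRegularLevy Z P Ψ) {δ b : ℝ} (hδ : 0 ≤ δ)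
    (hb : 0 < b) (t : ℝ) (k : ℕ) : ∫ ω, windowFunctional Z δ b t ω ^ k ∂P =
      k.factorial * (chainKernel (fun v => b ^ 2 * Ψ (v / b)) (Set.Ioc (-(b * δ)) (b * δ)) k
        (t ^ 2) 0).toReal := by
  simp_rw [windowFunctional_eq_occupation Z hb.ne']
  exact (h.rescale hb).integral_occupation_pow (by positivity) k (sq_nonneg t)

theorem integral_windowFunctional_pow_two_mul_le (h : IsRegularLevy Z P Ψ) {δ b t : ℝ}
    (hδ : 0 ≤ δ) (hb : 0 < b) (ht : 0 < t) {k : ℕ} (hk : 0 < ellLower Ψ (2 * k * δ)) :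
    ∫ ω, windowFunctional Z δ b t ω ^ (2 * k) ∂P ≤
      (t ^ 2 / (4 * ellLower Ψ (2 * k * δ))) ^ k * ((2 * k).factorial / k.factorial) := by
  have hdom : chainKernel (fun v => b ^ 2 * Ψ (v / b)) (Set.Ioc (-(b * δ)) (b * δ)) (2 * k)
      (t ^ 2) 0 ≤ chainKernel (fun v => ellLower Ψ (2 * k * δ) * v ^ 2) Set.univ (2 * k)
        (t ^ 2) 0 := by
    refine chainKernel_le_chainKernel (by positivity) measurableSet_Ioc
      (fun x hx => abs_le.2 ⟨hx.1.le, hx.2⟩) (R := 2 * k * δ * b)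
      (fun v hv => ellLower_mul_sq_le_rescale h.exponent_nonneg hb hv) (sq_nonneg t) ?_
    rw [abs_zero, zero_add]
    push_cast
    linarith
  have hΓ : Real.Gamma (1 + ((2 * k : ℕ) : ℝ) / 2) = k.factorial := by
    rw [Nat.cast_mul, Nat.cast_ofNat, mul_div_cancel_left₀ _ two_ne_zero, add_comm,
      Real.Gamma_nat_eq_factorial]
  rw [h.integral_windowFunctional_pow hδ hb]
  calc _ ≤ (2 * k).factorial * (chainKernel (fun v => ellLower Ψ (2 * k * δ) * v ^ 2) Set.univ
        (2 * k) (t ^ 2) 0).toReal := by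
        gcongr
        exact chainKernel_gaussian_zero_ne_top hk (by positivity) _
    _ = _ := by
        rw [factorial_mul_toReal_chainKernel_gaussian hk ht, hΓ, div_two_mul_sqrt_pow_two_mul hk.le]

theorem tendsto_integral_windowFunctional_pow (h : IsRegularLevy Z P Ψ) {ℓ : ℝ} (hℓ : 0 < ℓ)
    (hlim : Tendsto (fun x : ℝ => Ψ x / x ^ 2) (𝓝[>] 0) (𝓝 ℓ))
    (hint : Integrable fun x => 1 / (1 + Ψ x)) {ι : Type*} {l : Filter ι}
    [l.IsCountablyGenerated] {a : ι → ℝ} (ha_pos : ∀ i, 0 < a i) (ha : Tendsto a l atTop)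
    {δ t : ℝ} (hδ : 0 < δ) (ht : 0 < t) (k : ℕ) :
    Tendsto (fun i => ∫ ω, windowFunctional Z δ (a i) t ω ^ k ∂P) l
      (𝓝 ((t / (2 * √ℓ)) ^ k * (k.factorial / Real.Gamma (1 + (k : ℝ) / 2)))) := by
  have hΨ := h.continuous_exponent
  have hlow : ∀ R : ℝ, 0 < R → ∃ c, 0 < c ∧
      ∀ i v, |v| ≤ R * (a i * δ) → c * v ^ 2 ≤ a i ^ 2 * Ψ (v / a i) := fun R hR =>
    ⟨ellLower Ψ (R * δ), h.ellLower_pos hint hℓ hlim (by positivity), fun i v hv =>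
      ellLower_mul_sq_le_rescale h.exponent_nonneg (ha_pos i) (hv.trans_eq (by ring))⟩
  have hchain := tendsto_chainKernel (fun i => by fun_prop) (ha.atTop_mul_const hδ) hℓ
    (h.tendsto_sq_mul_exponent_div hlim ha_pos ha) hlow k (sq_nonneg t) 0
  simp_rw [h.integral_windowFunctional_pow hδ.le (ha_pos _),
    ← factorial_mul_toReal_chainKernel_gaussian hℓ ht]
  have hfin := chainKernel_gaussian_zero_ne_top hℓ (by positivity : 0 < t ^ 2) k
  exact ((ENNReal.tendsto_toReal hfin).comp hchain).const_mul _

end IsRegularLevy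

end Window

section ResidualPath

theorem tendsto_eLpNorm_two_zero {Ω E ι : Type*} [MeasurableSpace Ω] [NormedAddCommGroup E]
    {P : Measure Ω} {l : Filter ι} {Y : ι → Ω → E}
    (h : Tendsto (fun i => ∫⁻ ω, ‖Y i ω‖ₑ ^ 2 ∂P) l (𝓝 0)) :
    Tendsto (fun i => eLpNorm (Y i) 2 P) l (𝓝 0) := by
  have hroot := h.ennrpow_const (1 / 2)
  rw [ENNReal.zero_rpow_of_pos (by norm_num)] at hroot
  refine hroot.congr fun i => ?_
  rw [eLpNorm_eq_lintegral_rpow_enorm_toReal two_ne_zero ENNReal.ofNat_ne_top]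
  simp only [ENNReal.toReal_ofNat, ENNReal.rpow_ofNat]

namespace IsRegularLevy

variable {Ω : Type*} [MeasurableSpace Ω] {P : Measure Ω} {Z : ℝ → Ω → ℝ} {Ψ : ℝ → ℝ}

theorem integrableOn_phaseIntegral_path (h : IsRegularLevy Z P Ψ) {κ : ℝ → ℂ} (hκ : Measurable κ)
    (T : ℝ) (ω : Ω) : IntegrableOn (fun s => phaseIntegral κ (Z s ω)) (Set.Ioc 0 T) :=
  Integrable.of_bound
    ((h.measurable_phaseIntegral_path hκ).comp measurable_prodMk_left).aestronglyMeasurable _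
    (ae_of_all _ fun _ => norm_phaseIntegral_le κ _)

theorem memLp_setIntegral_phaseIntegral [IsFiniteMeasure P] (h : IsRegularLevy Z P Ψ) {κ : ℝ → ℂ}
    (hκ : Measurable κ) (T : ℝ) (p : ℝ≥0∞) :
    MemLp (fun ω => ∫ s in Set.Ioc 0 T, phaseIntegral κ (Z s ω)) p P := by
  have hmeas : StronglyMeasurable fun ω => ∫ s in Set.Ioc 0 T, phaseIntegral κ (Z s ω) :=
    (h.measurable_phaseIntegral_path hκ).stronglyMeasurable.integral_prod_right'
  exact MemLp.of_bound hmeas.aestronglyMeasurable ((∫ x, ‖κ x‖) * volume.real (Set.Ioc 0 T))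
    (ae_of_all _ fun ω =>
      norm_setIntegral_le_of_norm_le_const (by simp) fun s _ => norm_phaseIntegral_le κ _)

theorem additiveFunctional_ae_eq [IsProbabilityMeasure P] (h : IsRegularLevy Z P Ψ)
    (hint : Integrable fun x => 1 / (1 + Ψ x)) {X : ℝ≥0 → Ω → ℝ}
    (hX : ∀ᵐ ω ∂P, ∀ s : ℝ, Z s ω = X s.toNNReal ω) {f : ℝ → ℂ} (hf : Integrable f)
    (hf' : Integrable (angularFourier f)) (b t : ℝ) :
    ∀ᵐ ω ∂P, additiveFunctional X f b t ω = (b : ℂ)⁻¹ * ∫ s in Set.Ioc 0 (t ^ 2 * b ^ 2),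
      phaseIntegral (fun x => ((2 * Real.pi : ℝ) : ℂ)⁻¹ * angularFourier f x) (Z s ω) := by
  filter_upwards [hX, h.ae_comp_ae_eq hint (ae_eq_phaseIntegral_angularFourier hf hf')
    (t ^ 2 * b ^ 2)] with ω hω hinv
  rw [additiveFunctional, intervalIntegral.integral_of_le (by positivity)]
  simp_rw [← hω]
  rw [integral_congr_ae hinv]

theorem additiveFunctional_sub_windowFunctional_ae_eq [IsProbabilityMeasure P]
    (h : IsRegularLevy Z P Ψ) (hint : Integrable fun x => 1 / (1 + Ψ x)) {X : ℝ≥0 → Ω → ℝ}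
    (hX : ∀ᵐ ω ∂P, ∀ s : ℝ, Z s ω = X s.toNNReal ω) {f : ℝ → ℂ} (hf : Integrable f)
    (hf' : Integrable (angularFourier f)) {δ : ℝ} (hδ : 0 ≤ δ) (b t : ℝ) :
    (fun ω => additiveFunctional X f b t ω - angularFourier f 0 * windowFunctional Z δ b t ω) =ᵐ[P]
      fun ω => (b : ℂ)⁻¹ * ∫ s in Set.Ioc 0 (t ^ 2 * b ^ 2),
        phaseIntegral (residualSpectrum f δ) (Z s ω) := by
  have hT : 0 ≤ t ^ 2 * b ^ 2 := by positivity
  filter_upwards [h.additiveFunctional_ae_eq hint hX hf hf' b t] with ω hω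
  have hsinc : IntegrableOn (fun s => (sincKernel δ (Z s ω) : ℂ)) (Set.Ioc 0 (t ^ 2 * b ^ 2)) :=
    ((intervalIntegrable_iff_integrableOn_Ioc_of_le hT).1 (h.intervalIntegrable_comp
      (continuous_sincKernel δ).measurable (abs_sincKernel_le δ) ω _ _)).ofReal
  have hmeas := (measurable_angularFourier hf.aestronglyMeasurable).const_mul
    ((2 * Real.pi : ℝ) : ℂ)⁻¹
  simp_rw [phaseIntegral_residualSpectrum hf' hδ]
  rw [hω, integral_sub (h.integrableOn_phaseIntegral_path hmeas _ ω) (hsinc.const_mul _),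
    integral_const_mul, integral_complex_ofReal, windowFunctional, occupation,
    intervalIntegral.integral_of_le hT]
  push_cast
  ring

end IsRegularLevy

end ResidualPath

section Main

theorem tendsto_liminf_limsup_of_forall_tendsto {ι : Type*} {l : Filter ι} [l.NeBot]
    {u : ℝ → ι → ℝ} {c : ℝ} (h : ∀ δ > 0, Tendsto (u δ) l (𝓝 c)) :
    Tendsto (fun δ => liminf (u δ) l) (𝓝[>] 0) (𝓝 c) ∧
      Tendsto (fun δ => limsup (u δ) l) (𝓝[>] 0) (𝓝 c) := by
  constructor <;> refine tendsto_const_nhds.congr' ?_ <;>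
    filter_upwards [self_mem_nhdsWithin] with δ hδ
  · exact (h δ hδ).liminf_eq.symm
  · exact (h δ hδ).limsup_eq.symm

theorem IsRegularLevy.tendsto_eLpNorm_residual {Ω : Type*} [MeasurableSpace Ω] {P : Measure Ω}
    [IsProbabilityMeasure P] {Z : ℝ → Ω → ℝ} {Ψ : ℝ → ℝ} (h : IsRegularLevy Z P Ψ) {ℓ : ℝ}
    (hℓ : 0 < ℓ) (hlim : Tendsto (fun x : ℝ => Ψ x / x ^ 2) (𝓝[>] 0) (𝓝 ℓ))
    (hint : Integrable fun x => 1 / (1 + Ψ x)) {f : ℝ → ℂ} (hf : IsAdmissible f) {δ : ℝ}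
    (hδ : 0 < δ) {ι : Type*} {l : Filter ι} [l.IsCountablyGenerated] {a : ι → ℝ}
    (ha : Tendsto a l atTop) (t : ℝ) :
    Tendsto (fun i => eLpNorm (fun ω => (a i : ℂ)⁻¹ * ∫ s in Set.Ioc 0 (t ^ 2 * a i ^ 2),
      phaseIntegral (residualSpectrum f δ) (Z s ω)) 2 P) l (𝓝 0) := by
  have hfm := (memLp_one_iff_integrable.1 hf.memLp_one).aestronglyMeasurable
  obtain ⟨c, hc, hfar⟩ := h.exists_pos_forall_le_exponent hint hδ
  have hnear : ∀ x, |x| ≤ δ → ellLower Ψ δ * x ^ 2 ≤ Ψ x := fun x =>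
    ellLower_mul_sq_le h.exponent_nonneg
  exact tendsto_eLpNorm_two_zero <| h.tendsto_lintegral_enorm_setIntegral_phaseIntegral_sq
    (fun x hx => h.exponent_pos hint hx) hint (measurable_residualSpectrum hfm δ)
    (integrable_residualSpectrum hf.fourier_integrable δ) (norm_residualSpectrum_le f δ)
    (lintegral_residualSpectrum_ne_top hf.fourier_integrable hf.fourier_sub_integrable
      (h.ellLower_pos hint hℓ hlim hδ) hnear hc hfar) ha t

theorem theorem1p1_general {Ω : Type*} [MeasurableSpace Ω] (P : Measure Ω) [IsProbabilityMeasure P]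
    (X : ℝ≥0 → Ω → ℝ) (hX : IsLevyProcess X P) (Ψ : ℝ → ℝ) (hXΨ : HasCharExponent X P Ψ)
    (ℓ : ℝ) (hℓ : 0 < ℓ) (hΨ_zero : Tendsto (fun x : ℝ => Ψ x / x ^ 2) (𝓝[>] 0) (𝓝 ℓ))
    (hΨ_int : Integrable (fun x : ℝ => 1 / (1 + Ψ x)) volume)
    {ι : Type*} (l : Filter ι) [l.IsCountablyGenerated] (a : ι → ℝ) (ha_pos : ∀ i, 0 < a i)
    (ha_top : Tendsto a l atTop)
    (f : ℝ → ℂ) (hf : IsAdmissible f) (t : ℝ) (ht : 0 < t) :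
    ∃ (I₁ : ℝ → ι → Ω → ℂ) (I₂ : ℝ → ι → Ω → ℝ),
      (∀ δ : ℝ, 0 < δ →
        (∀ i ω, additiveFunctional X f (a i) t ω =
          I₁ δ i ω + angularFourier f 0 * (I₂ δ i ω : ℂ)) ∧
        (∀ i, MemLp (I₁ δ i) 2 P) ∧
        Tendsto (fun i => eLpNorm (I₁ δ i) 2 P) l (𝓝 0) ∧
        (∀ k : ℕ, 1 ≤ k → ∀ i,
          Integrable (fun ω => |I₂ δ i ω| ^ (2 * k)) P ∧
          ∫ ω, |I₂ δ i ω| ^ (2 * k) ∂P ≤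
            (t ^ 2 / (4 * ellLower Ψ (2 * (k : ℝ) * δ))) ^ k *
              ((Nat.factorial (2 * k) : ℝ) / (Nat.factorial k : ℝ))) ∧
        (∀ k : ℕ, 1 ≤ k → UniformIntegrable (fun i ω => I₂ δ i ω ^ k) 1 P)) ∧
      ∀ δ : ℝ, 0 < δ → ∀ k : ℕ, Tendsto (fun i => ∫ ω, I₂ δ i ω ^ k ∂P) l
        (𝓝 ((t / (2 * √ℓ)) ^ k * ((Nat.factorial k : ℝ) / Real.Gamma (1 + (k : ℝ) / 2)))) := by
  obtain ⟨Z, hZ, hZX⟩ := hX.exists_isRegularLevy hXΨ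
  have hfi := memLp_one_iff_integrable.1 hf.memLp_one
  have hres := fun {δ : ℝ} (hδ : 0 < δ) i => hZ.additiveFunctional_sub_windowFunctional_ae_eq
    hΨ_int hZX hfi hf.fourier_integrable hδ.le (a i) t
  have hmom : ∀ {δ : ℝ}, 0 < δ → ∀ {k : ℕ}, 1 ≤ k → ∀ i,
      ∫ ω, windowFunctional Z δ (a i) t ω ^ (2 * k) ∂P ≤
        (t ^ 2 / (4 * ellLower Ψ (2 * k * δ))) ^ k * ((2 * k).factorial / k.factorial) :=
    fun hδ _ hk i => hZ.integral_windowFunctional_pow_two_mul_le hδ.le (ha_pos i) ht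
      (hZ.ellLower_pos hΨ_int hℓ hΨ_zero (by positivity))
  refine ⟨fun δ i ω => additiveFunctional X f (a i) t ω -
    angularFourier f 0 * windowFunctional Z δ (a i) t ω, fun δ i => windowFunctional Z δ (a i) t,
    fun δ hδ => ⟨fun i ω => (sub_add_cancel _ _).symm, fun i => ?_, ?_, fun k hk i => ?_,
      fun k hk => ?_⟩, fun δ hδ =>
    hZ.tendsto_integral_windowFunctional_pow hℓ hΨ_zero hΨ_int ha_pos ha_top hδ ht⟩
  · exact ((hZ.memLp_setIntegral_phaseIntegral (measurable_residualSpectrum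
      hfi.aestronglyMeasurable δ) _ 2).const_mul _).ae_eq (hres hδ i).symm
  · simp_rw [eLpNorm_congr_ae (hres hδ _)]
    exact hZ.tendsto_eLpNorm_residual hℓ hΨ_zero hΨ_int hf hδ ha_top t
  · simp_rw [(even_two_mul k).pow_abs]
    exact ⟨memLp_one_iff_integrable.1 (hZ.memLp_windowFunctional_pow δ _ t _ 1), hmom hδ hk i⟩
  · have hsq := hmom hδ hk
    simp_rw [mul_comm 2 k, pow_mul] at hsq
    exact uniformIntegrable_of_integral_sq_le
      (fun i => hZ.memLp_windowFunctional_pow δ _ t k 2) hsq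

end Main

theorem theorem1p1 {Ω : Type*} [MeasurableSpace Ω] (P : Measure Ω) [IsProbabilityMeasure P]
    (X : ℝ≥0 → Ω → ℝ) (hX : IsLevyProcess X P) (hXsymm : IsSymmetricProcess X P)
    (Ψ : ℝ → ℝ) (hXΨ : HasCharExponent X P Ψ)
    (hΨ_radial : ∀ x, Ψ x = Ψ |x|) (hΨ_nonneg : ∀ x, 0 ≤ Ψ x)
    (hΨ_mono : MonotoneOn Ψ (Set.Ici 0))
    (ℓ : ℝ) (hℓ : 0 < ℓ)
    (hΨ_zero : Tendsto (fun x : ℝ => Ψ x / x ^ 2) (𝓝[>] 0) (𝓝 ℓ))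
    (hΨ_HW : Tendsto (fun x : ℝ => Ψ x / Real.log (|x| + 1)) atTop atTop)
    (hΨ_int : Integrable (fun x : ℝ => 1 / (1 + Ψ x)) volume)
    (a : ℕ → ℝ) (ha_pos : ∀ n, 0 < a n) (ha_mono : Monotone a)
    (ha_top : Tendsto a atTop atTop)
    (f : ℝ → ℂ) (hf : IsAdmissible f) (t : ℝ) (ht : 0 < t) :
    ∃ (I₁ : ℝ → ℕ → Ω → ℂ) (I₂ : ℝ → ℕ → Ω → ℝ),
      (∀ δ : ℝ, 0 < δ →
        -- the decomposition
        (∀ n ω, additiveFunctional X f (a n) t ω =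
          I₁ δ n ω + angularFourier f 0 * (I₂ δ n ω : ℂ)) ∧
        -- the first part converges to zero in `L²`
        (∀ n, MemLp (I₁ δ n) 2 P) ∧
        Tendsto (fun n => eLpNorm (I₁ δ n) 2 P) atTop (𝓝 0) ∧
        -- the bound on the even moments, uniformly in `n`
        (∀ k : ℕ, 1 ≤ k → ∀ n,
          Integrable (fun ω => |I₂ δ n ω| ^ (2 * k)) P ∧
          ∫ ω, |I₂ δ n ω| ^ (2 * k) ∂P ≤
            (t ^ 2 / (4 * ellLower Ψ (2 * (k : ℝ) * δ))) ^ k *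
              ((Nat.factorial (2 * k) : ℝ) / (Nat.factorial k : ℝ))) ∧
        -- uniform integrability of all powers
        (∀ k : ℕ, 1 ≤ k → UniformIntegrable (fun n ω => I₂ δ n ω ^ k) 1 P)) ∧
      -- the limits of the moments
      (∀ k : ℕ, 1 ≤ k →
        Tendsto (fun δ : ℝ => liminf (fun n => ∫ ω, I₂ δ n ω ^ k ∂P) atTop) (𝓝[>] 0)
          (𝓝 ((t / (2 * √ℓ)) ^ k * ((Nat.factorial k : ℝ) / Real.Gamma (1 + (k : ℝ) / 2)))) ∧
        Tendsto (fun δ : ℝ => limsup (fun n => ∫ ω, I₂ δ n ω ^ k ∂P) atTop) (𝓝[>] 0)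
          (𝓝 ((t / (2 * √ℓ)) ^ k * ((Nat.factorial k : ℝ) / Real.Gamma (1 + (k : ℝ) / 2))))) := by
  obtain ⟨I₁, I₂, h, hlim⟩ :=
    theorem1p1_general P X hX Ψ hXΨ ℓ hℓ hΨ_zero hΨ_int atTop a ha_pos ha_top f hf t ht
  exact ⟨I₁, I₂, h, fun k _ => tendsto_liminf_limsup_of_forall_tendsto fun δ hδ => hlim δ hδ k⟩
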